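/- Let $N\ge 1$ be an integer, $b>0$ and $Z\ge 0$. Let $\mathcal P$ (resp. $\mathcal P^-$) be the set of Borel probabilities (resp. Borel measures of total mass at most $1$) on $\mathbb R^3$, the latter with the weak* topology (duality with the continuous functions vanishing at infinity). For $\rho\in\mathcal P$ put $$T(\rho)=\int_{\mathbb R^3}|\nabla\sqrt\rho|^2\,dx$$ if $\rho$ is absolutely continuous with $\sqrt\rho\in H^1(\mathbb R^3)$, and $T(\rho)=+\infty$ otherwise, $$C(\rho)=\inf\Big\{\int_{\mathbb R^{3N}}\sum_{1\le i<j\le N}\frac{1}{|x_i-x_j|}\,dP\ :\ P \text{ a Borel probability on } (\mathbb R^{3})^N \text{ with all } N \text{ marginals equal to } \rho\Big\},\qquad U_0(\rho)=\int\frac{1}{|x|}\,d\rho(x).$$ For $\varepsilon>0$ let $G_\varepsilon(\rho)=\varepsilon^2T(\rho)+\varepsilon bC(\rho)-\varepsilon Z\,U_0(\rho)$ if $\rho\in\mathcal P$ and $T(\rho)<\infty$, and $G_\varepsilon(\rho)=+\infty$ for all other $\rho\in\mathcal P^-$ (one nucleus, of charge $Z$, at the origin). Let $G^-$ and $G^+$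 be the $\Gamma$-lower and $\Gamma$-upper limits on $\mathcal P^-$ of the family $G_\varepsilon$ as $\varepsilon\to0^+$, with respect to the weak* topology. For $\alpha\in[0,1]$ define $$g_b(Z,\alpha)=\sup_{R>0}\ \inf\big\{T(\rho)+bC(\rho)-Z\,U_0(\rho)\ :\ \rho\in\mathcal P,\ T(\rho)<\infty,\ \rho(B(0,R))\le\alpha\big\}.$$ Then for every $\alpha\in[0,1]$ the $\Gamma$-limit $G$ of the family $G_\varepsilon$ exists at $\alpha\delta_0$ and $G(\alpha\delta_0)=g_b(Z,\alpha)$, that is, $$G^-(\alpha\delta_0)=G^+(\alpha\delta_0)=g_b(Z,\alpha).$$ Moreover $$G^-(\alpha\delta_0+\rho^\perp)\ge g_b(Z,\alpha)$$ for every $\alpha\in[0,1]$ and every Borel measure $\rho^\perp\ge0$ on $\mathbb R^3$ with $\rho^\perp(\{0\})=0$ and $\alpha\delta_0+\rho^\perp\in\mathcal P^-$. -/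

import Mathlib

open MeasureTheory Filter Topology
open scoped ENNReal ContDiff

namespace Dissoc

/-- The physical space `ℝ³` with its Euclidean norm. -/
abbrev E3 : Type := EuclideanSpace ℝ (Fin 3)

/-- Borel subprobabilities on `ℝ³`. -/
structure SubProb where
  /-- the underlying measure -/
  toMeasure : Measure E3
  mass_le_one : toMeasure Set.univ ≤ 1

/-- The weak* topology on subprobabilities: the coarsest topology for which
`ρ ↦ ∫ f dρ` is continuous for every continuous `f` vanishing at infinity. -/
noncomputable instance : TopologicalSpace SubProb :=
  TopologicalSpace.induced
    (fun (ρ : SubProb) (f : ZeroAtInftyContinuousMap E3 ℝ) => ∫ x, f x ∂ρ.toMeasure)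
    inferInstance

/-- `v` is the weak (distributional) gradient of `u` on `ℝ³`. -/
def IsWeakGradient (u : E3 → ℝ) (v : E3 → E3) : Prop :=
  ∀ φ : E3 → ℝ, ContDiff ℝ ∞ φ → HasCompactSupport φ → ∀ e : E3,
    ∫ x, u x * fderiv ℝ φ x e = - ∫ x, inner ℝ (v x) e * φ x

/-- The kinetic energy `T(ρ) = ∫ |∇√ρ|² dx`. It is `∞` unless `ρ` has a density of the form `u²`
with `u ≥ 0` in `H¹(ℝ³)`; then `u = √ρ` and its weak gradient are unique almost everywhere, so that
the infimum is over one value only. -/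
noncomputable def kinetic (ρ : Measure E3) : ℝ≥0∞ :=
  ⨅ (u : E3 → ℝ) (v : E3 → E3) (_ : ∀ x, 0 ≤ u x) (_ : MemLp u 2 volume) (_ : MemLp v 2 volume)
    (_ : IsWeakGradient u v)
    (_ : ρ = volume.withDensity (fun x => ENNReal.ofReal (u x ^ 2))),
    ∫⁻ x, ‖v x‖ₑ ^ 2

/-- The Coulomb cost `∑_{i<j} 1/|x_i - x_j|`, with the value `∞` where two points coincide. -/
noncomputable def coulombCost {N : ℕ} (x : Fin N → E3) : ℝ≥0∞ :=
  ∑ p : Fin N × Fin N with p.1 < p.2, ‖x p.1 - x p.2‖ₑ⁻¹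

/-- The correlation term `C(ρ)`: the multimarginal transport cost with all `N` marginals `ρ`. -/
noncomputable def correlation (N : ℕ) (ρ : Measure E3) : ℝ≥0∞ :=
  ⨅ (P : Measure (Fin N → E3)) (_ : IsProbabilityMeasure P)
    (_ : ∀ i : Fin N, P.map (fun x => x i) = ρ), ∫⁻ x, coulombCost x ∂P

/-- The potential `U₀(ρ) = ∫ 1/|x| dρ` of a unit charge at the origin. -/
noncomputable def potential (ρ : Measure E3) : ℝ≥0∞ :=
  ∫⁻ x, ‖x‖ₑ⁻¹ ∂ρ

open scoped Classical in
/-- The combination `t T(ρ) + c C(ρ) - z U₀(ρ)`, with the value `+∞` outside the domain of `T`.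
On that domain `U₀` is finite, so no `∞ - ∞` occurs. -/
noncomputable def energy (N : ℕ) (t c z : ℝ) (ρ : Measure E3) : EReal :=
  if kinetic ρ = ⊤ then ⊤
  else ((ENNReal.ofReal t * kinetic ρ + ENNReal.ofReal c * correlation N ρ : ℝ≥0∞) : EReal)
    - ((ENNReal.ofReal z * potential ρ : ℝ≥0∞) : EReal)

open scoped Classical in
/-- The functional `G_ε = ε² T + ε b C - ε Z U₀` for one nucleus of charge `Z` at the origin,
defined on probabilities and extended by `+∞` to the other subprobabilities. -/
noncomputable def Geps (N : ℕ) (b Z ε : ℝ) (ρ : SubProb) : EReal :=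
  if IsProbabilityMeasure ρ.toMeasure then energy N (ε ^ 2) (ε * b) (ε * Z) ρ.toMeasure else ⊤

/-- The `Γ`-lower limit of a family of functionals along a filter. -/
noncomputable def gammaLiminf {ι X : Type*} [TopologicalSpace X] (l : Filter ι)
    (F : ι → X → EReal) (x : X) : EReal :=
  ⨆ U ∈ 𝓝 x, liminf (fun i => ⨅ y ∈ U, F i y) l

/-- The `Γ`-upper limit of a family of functionals along a filter. -/
noncomputable def gammaLimsup {ι X : Type*} [TopologicalSpace X] (l : Filter ι)
    (F : ι → X → EReal) (x : X) : EReal :=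
  ⨆ U ∈ 𝓝 x, limsup (fun i => ⨅ y ∈ U, F i y) l

/-- `G⁻`, the `Γ`-lower limit of `G_ε` as `ε → 0⁺`. -/
noncomputable def Gminus (N : ℕ) (b Z : ℝ) : SubProb → EReal :=
  gammaLiminf (𝓝[>] (0 : ℝ)) (Geps N b Z)

/-- `G⁺`, the `Γ`-upper limit of `G_ε` as `ε → 0⁺`. -/
noncomputable def Gplus (N : ℕ) (b Z : ℝ) : SubProb → EReal :=
  gammaLimsup (𝓝[>] (0 : ℝ)) (Geps N b Z)

/-- The `Γ`-limit `G` of the whole family `G_ε` exists at `ρ` and has the value `g`. -/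
def IsGammaLimitAt (N : ℕ) (b Z : ℝ) (ρ : SubProb) (g : EReal) : Prop :=
  Gminus N b Z ρ = g ∧ Gplus N b Z ρ = g

/-- `g_b^R(Z, α)`. -/
noncomputable def gbR (N : ℕ) (b R Z α : ℝ) : EReal :=
  ⨅ (ρ : Measure E3) (_ : IsProbabilityMeasure ρ)
    (_ : ρ (Metric.ball 0 R) ≤ ENNReal.ofReal α), energy N 1 b Z ρ

/-- `g_b(Z, α) = sup_{R > 0} g_b^R(Z, α)`. -/
noncomputable def gb (N : ℕ) (b Z α : ℝ) : EReal :=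
  ⨆ (R : ℝ) (_ : 0 < R), gbR N b R Z α

/-- The measure `α δ₀`. -/
noncomputable def atomAtZero (α : ℝ) : Measure E3 :=
  ENNReal.ofReal α • Measure.dirac (0 : E3)

theorem atomAtZero_mass_le_one {α : ℝ} (hα : α ∈ Set.Icc (0 : ℝ) 1) :
    atomAtZero α Set.univ ≤ 1 := by
  simpa [atomAtZero] using hα.2

end Dissoc

namespace Dissoc

/-! Write E = T + bC − ZU₀. Under dilation by λ the kinetic term scales like λ⁻² and the two Coulomb
terms like λ⁻¹, so G_ε(ρ) is E evaluated at the dilation of ρ by ε⁻¹. Concentration at the origin at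
scale ε becomes the question of how much mass stays at bounded distance in the blown-up picture, and
the rest may drift to infinity.

Lower bound: weak* closeness to μ bounds the mass near the origin by μ({0}) plus a little, so the
blown-up measure has mass at most α + δ in a large ball. The constrained infimum is semicontinuous
from the right in α (`exists_le_gbR_add`), and δ disappears. Only the atom at 0 matters, so one
argument (`gb_le_Gminus`) serves both claims. Upper bound: take a near-minimiser with mass at most α
in a large ball, keep a portion of mass almost α around the origin, send the remainder so far that
test functions vanishing at infinity do not see it, and dilate by ε (`exists_recovery`).

Both halves rest on one operation, `relocate`: keep the fraction ζ² of ρ and spread the removed mass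
over a distant, very flat density w². The root of the new density is ζ√ρ + a·w with disjoint
supports, so T pays only for gradients of cutoffs. Replacing particles of a coupling by independent
ones with law w² makes C pay little, since w² has a uniformly small Coulomb potential. U₀ loses only
what the removed mass contributed. The last two controls, and the bound of T by E, come from Hardy's
inequality ∫u²/|x|² ≤ 4∫|∇u|². -/

/-! ### Hardy's inequality for `C¹` functions -/

/-- Integrating the divergence of x ↦ g(x)x gives zero; the 3 is the dimension. -/
theorem integral_fderiv_apply_self {g : E3 → ℝ} (hg : ContDiff ℝ 1 g) (h1 : Integrable g)
    (h2 : Integrable fun x => ‖x‖ * g x) (h3 : Integrable fun x => ‖x‖ * ‖fderiv ℝ g x‖) :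
    Integrable (fun x => fderiv ℝ g x x) ∧ ∫ x, fderiv ℝ g x x = -3 * ∫ x, g x := by
  have hc : Continuous (fderiv ℝ g) := hg.continuous_fderiv one_ne_zero
  let e : Fin 3 → E3 := fun i => EuclideanSpace.single i 1
  have he : ∀ i, ‖e i‖ = 1 := fun i => by simp [e]
  have hint : ∀ i, Integrable fun x : E3 => x i * fderiv ℝ g x (e i) := fun i => by
    refine h3.mono' (by fun_prop) (ae_of_all _ fun x => ?_)
    rw [norm_mul]
    gcongr
    · exact PiLp.norm_apply_le x i
    · simpa [he] using (fderiv ℝ g x).le_opNorm (e i)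
  have hsum : ∀ x : E3, fderiv ℝ g x x = ∑ i, x i * fderiv ℝ g x (e i) := fun x => by
    conv_lhs => arg 2; rw [← (EuclideanSpace.basisFun (Fin 3) ℝ).sum_repr x]
    simp only [map_sum, map_smul, smul_eq_mul]
    simp [e]
  have hparts : ∀ i, ∫ x : E3, x i * fderiv ℝ g x (e i) = - ∫ x, g x := fun i => by
    have hd : ∀ x : E3, HasFDerivAt (fun x : E3 => x i)
        (EuclideanSpace.proj i : E3 →L[ℝ] ℝ) x := fun x =>
      (EuclideanSpace.proj i : E3 →L[ℝ] ℝ).hasFDerivAt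
    have hd' : ∀ x : E3, fderiv ℝ (fun x : E3 => x i) x (e i) = 1 := fun x => by
      rw [(hd x).fderiv]; simp [e]
    have := integral_mul_fderiv_eq_neg_fderiv_mul_of_integrable (μ := volume)
      (f := fun x : E3 => x i) (g := g) (v := e i) (by simpa [hd'] using h1) (hint i)
      (by
        refine h2.norm.mono' (by have := hg.continuous; fun_prop) (ae_of_all _ fun x => ?_)
        rw [norm_mul, norm_mul, norm_norm]
        gcongr
        exact PiLp.norm_apply_le x i)
      (fun x _ => (hd x).differentiableAt)
      (fun x _ => (hg.differentiable one_ne_zero) x)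
    simpa [hd'] using this
  simp only [hsum]
  refine ⟨integrable_finsetSum _ fun i _ => hint i, ?_⟩
  rw [integral_finsetSum _ fun i _ => hint i]
  simp only [hparts]
  simp

/-- A regularised Hardy inequality for `C¹` functions. -/
theorem hardy_regularised {f : E3 → ℝ} (hf : ContDiff ℝ 1 f) (h1 : Integrable fun x => f x ^ 2)
    (h2 : Integrable fun x => ‖fderiv ℝ f x‖ ^ 2) {κ : ℝ} (hκ : 0 < κ) :
    Integrable (fun x => f x ^ 2 / (‖x‖ ^ 2 + κ)) ∧
    ∫ x, f x ^ 2 / (‖x‖ ^ 2 + κ) ≤ 4 * ∫ x, ‖fderiv ℝ f x‖ ^ 2 := by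
  have hq : ∀ x : E3, 0 < ‖x‖ ^ 2 + κ := fun x => by positivity
  -- One constant dominating both 1/(|x|² + κ) and |x|/(|x|² + κ), which supplies all the
  -- integrability below.
  set c : ℝ := κ⁻¹ + 1 with hc
  have hc0 : 0 < c := by positivity
  have hb1 : ∀ x : E3, 1 / (‖x‖ ^ 2 + κ) ≤ c := fun x => by
    rw [div_le_iff₀ (hq x), hc]
    have : κ⁻¹ * κ = 1 := inv_mul_cancel₀ hκ.ne'
    have : 0 ≤ κ⁻¹ * ‖x‖ ^ 2 := by positivity
    nlinarith [sq_nonneg ‖x‖]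
  have hb2 : ∀ x : E3, ‖x‖ / (‖x‖ ^ 2 + κ) ≤ c := fun x => by
    rw [div_le_iff₀ (hq x), hc]
    have : κ⁻¹ * κ = 1 := inv_mul_cancel₀ hκ.ne'
    have : 0 ≤ κ⁻¹ * ‖x‖ ^ 2 := by positivity
    nlinarith [sq_nonneg (‖x‖ - 1)]
  have hb3 : ∀ x : E3, ‖x‖ ^ 2 / (‖x‖ ^ 2 + κ) ≤ 1 := fun x => by
    rw [div_le_one (hq x)]; linarith
  set g : E3 → ℝ := fun x => f x ^ 2 / (‖x‖ ^ 2 + κ) with hgdef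
  have hgc : ContDiff ℝ 1 g := by
    refine (hf.pow 2).div ((contDiff_norm_sq ℝ).add contDiff_const) fun x => (hq x).ne'
  have hD : ∀ x, HasFDerivAt g ((2 * f x / (‖x‖ ^ 2 + κ)) • fderiv ℝ f x
      - (2 * f x ^ 2 / (‖x‖ ^ 2 + κ) ^ 2) • innerSL ℝ x) x := fun x => by
    have h := ((hf.differentiable one_ne_zero x).hasFDerivAt.pow 2).mul
      ((hasDerivAt_inv (hq x).ne').comp_hasFDerivAt x
        ((hasStrictFDerivAt_norm_sq x).hasFDerivAt.add_const κ))
    refine (h.congr_of_eventuallyEq (Eventually.of_forall fun y => by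
      simp [hgdef, div_eq_mul_inv])).congr_fderiv ?_
    ext y
    simp
    have := (hq x).ne'
    field_simp
    ring
  have hDn : ∀ x, ‖x‖ * ‖fderiv ℝ g x‖ ≤ c * (f x ^ 2 + ‖fderiv ℝ f x‖ ^ 2) + 2 * c * f x ^ 2 := by
    intro x
    rw [(hD x).fderiv]
    have hn : ‖(2 * f x / (‖x‖ ^ 2 + κ)) • fderiv ℝ f x
        - (2 * f x ^ 2 / (‖x‖ ^ 2 + κ) ^ 2) • innerSL ℝ x‖
        ≤ (2 * |f x| / (‖x‖ ^ 2 + κ)) * ‖fderiv ℝ f x‖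
          + (2 * f x ^ 2 / (‖x‖ ^ 2 + κ) ^ 2) * ‖x‖ := by
      refine (norm_sub_le _ _).trans (le_of_eq ?_)
      rw [norm_smul, norm_smul, innerSL_apply_norm]
      simp [abs_of_pos (hq x)]
    calc ‖x‖ * _ ≤ ‖x‖ * _ := mul_le_mul_of_nonneg_left hn (norm_nonneg _)
      _ = (‖x‖ / (‖x‖ ^ 2 + κ)) * (2 * |f x| * ‖fderiv ℝ f x‖)
          + 2 * f x ^ 2 * ((1 / (‖x‖ ^ 2 + κ)) * (‖x‖ ^ 2 / (‖x‖ ^ 2 + κ))) := by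
        have := (hq x).ne'
        field_simp
      _ ≤ c * (f x ^ 2 + ‖fderiv ℝ f x‖ ^ 2) + 2 * f x ^ 2 * (c * 1) := by
        gcongr
        · exact hb2 x
        · nlinarith [sq_nonneg (|f x| - ‖fderiv ℝ f x‖), sq_abs (f x)]
        · exact hb1 x
        · exact hb3 x
      _ = _ := by ring
  have hg1 : Integrable g := by
    refine (h1.const_mul c).mono' hgc.continuous.aestronglyMeasurable (ae_of_all _ fun x => ?_)
    rw [Real.norm_of_nonneg (div_nonneg (sq_nonneg _) (hq x).le)]
    calc g x = (1 / (‖x‖ ^ 2 + κ)) * f x ^ 2 := by simp [hgdef, div_eq_mul_inv, mul_comm]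
      _ ≤ _ := by gcongr; exact hb1 x
  have hg2 : Integrable fun x => ‖x‖ * g x := by
    have := hgc.continuous
    refine (h1.const_mul c).mono' (by fun_prop) (ae_of_all _ fun x => ?_)
    rw [Real.norm_of_nonneg (mul_nonneg (norm_nonneg _) (div_nonneg (sq_nonneg _) (hq x).le))]
    calc ‖x‖ * g x = (‖x‖ / (‖x‖ ^ 2 + κ)) * f x ^ 2 := by simp [hgdef, div_eq_mul_inv]; ring
      _ ≤ _ := by gcongr; exact hb2 x
  have hg3 : Integrable fun x => ‖x‖ * ‖fderiv ℝ g x‖ := by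
    have := hgc.continuous_fderiv one_ne_zero
    refine (((h1.add h2).const_mul c).add (h1.const_mul (2 * c))).mono' (by fun_prop)
      (ae_of_all _ fun x => ?_)
    rw [norm_mul, norm_norm, norm_norm]
    exact hDn x
  obtain ⟨hi, heq⟩ := integral_fderiv_apply_self hgc hg1 hg2 hg3
  refine ⟨hg1, ?_⟩
  -- With A = |f||x|/(|x|² + κ), the integrand is at most 2A|∇f| + 2A², where A² ≤ g and 2A|∇f| ≤
  -- A²/2 + 2|∇f|². As the left side equals 3∫g, subtracting (5/2)∫g leaves ∫g/2 ≤ 2∫|∇f|², hence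
  -- the constant 4.
  have hle : ∫ x, -fderiv ℝ g x x ≤ ∫ x, (5 / 2 * g x + 2 * ‖fderiv ℝ f x‖ ^ 2) := by
    refine integral_mono hi.neg ((hg1.const_mul _).add (h2.const_mul _)) fun x => ?_
    simp only [(hD x).fderiv]
    simp only [sub_apply, smul_apply, smul_eq_mul,
      innerSL_apply_apply, real_inner_self_eq_norm_sq, hgdef]
    have hA : |fderiv ℝ f x x| ≤ ‖fderiv ℝ f x‖ * ‖x‖ := (fderiv ℝ f x).le_opNorm x
    have hB : -(2 * f x / (‖x‖ ^ 2 + κ) * fderiv ℝ f x x)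
        ≤ 2 * ((|f x| * ‖x‖ / (‖x‖ ^ 2 + κ)) * ‖fderiv ℝ f x‖) := by
      refine (neg_le_abs _).trans ?_
      rw [abs_mul, abs_div, abs_mul, abs_of_pos (hq x), abs_two]
      calc 2 * |f x| / (‖x‖ ^ 2 + κ) * |fderiv ℝ f x x|
          ≤ 2 * |f x| / (‖x‖ ^ 2 + κ) * (‖fderiv ℝ f x‖ * ‖x‖) := by gcongr
        _ = _ := by ring
    have hC : (|f x| * ‖x‖ / (‖x‖ ^ 2 + κ)) ^ 2 = f x ^ 2 * ‖x‖ ^ 2 / (‖x‖ ^ 2 + κ) ^ 2 := by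
      rw [div_pow, mul_pow, sq_abs]
    have hE : f x ^ 2 * ‖x‖ ^ 2 / (‖x‖ ^ 2 + κ) ^ 2 ≤ f x ^ 2 / (‖x‖ ^ 2 + κ) := by
      calc _ = f x ^ 2 / (‖x‖ ^ 2 + κ) * (‖x‖ ^ 2 / (‖x‖ ^ 2 + κ)) := by
            have := (hq x).ne'
            field_simp
        _ ≤ f x ^ 2 / (‖x‖ ^ 2 + κ) * 1 := by
          have := (hq x).le
          gcongr
          exact hb3 x
        _ = _ := mul_one _
    have hF : 2 * f x ^ 2 / (‖x‖ ^ 2 + κ) ^ 2 * ‖x‖ ^ 2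
        = 2 * (f x ^ 2 * ‖x‖ ^ 2 / (‖x‖ ^ 2 + κ) ^ 2) := by ring
    rw [hF]
    nlinarith [sq_nonneg (|f x| * ‖x‖ / (‖x‖ ^ 2 + κ) - 2 * ‖fderiv ℝ f x‖)]
  rw [integral_neg, heq, integral_add (hg1.const_mul _) (h2.const_mul _), integral_const_mul,
    integral_const_mul] at hle
  change ∫ x, g x ≤ _
  linarith

/-- Fatou's lemma, used to remove first the regularisation κ and then the mollification. -/
theorem lintegral_le_of_ae_tendsto {X : Type*} [MeasurableSpace X] {μ : Measure X}
    {F : ℕ → X → ℝ≥0∞} {G : X → ℝ≥0∞} {C : ℝ≥0∞} (hF : ∀ n, AEMeasurable (F n) μ)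
    (hC : ∀ n, ∫⁻ x, F n x ∂μ ≤ C)
    (hG : ∀ᵐ x ∂μ, Tendsto (fun n => F n x) atTop (𝓝 (G x))) : ∫⁻ x, G x ∂μ ≤ C :=
  calc ∫⁻ x, G x ∂μ = ∫⁻ x, liminf (fun n => F n x) atTop ∂μ :=
        lintegral_congr_ae (hG.mono fun _ h => h.liminf_eq.symm)
    _ ≤ liminf (fun n => ∫⁻ x, F n x ∂μ) atTop := lintegral_liminf_le' hF
    _ ≤ liminf (fun _ : ℕ => C) atTop := liminf_le_liminf (Eventually.of_forall hC)
    _ = C := liminf_const C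

theorem sq_lintegral_mul_le {X : Type*} [MeasurableSpace X] {μ : Measure X} {f g : X → ℝ≥0∞}
    (hf : AEMeasurable f μ) (hg : AEMeasurable g μ) :
    (∫⁻ x, f x * g x ∂μ) ^ 2 ≤ (∫⁻ x, f x ^ 2 ∂μ) * ∫⁻ x, g x ^ 2 ∂μ := by
  have h := ENNReal.lintegral_mul_le_Lp_mul_Lq μ Real.HolderConjugate.two_two hf hg
  simp only [Pi.mul_apply, ENNReal.rpow_two] at h
  calc _ ≤ _ := pow_le_pow_left' h 2
    _ = _ := by
      rw [mul_pow]
      simp only [← ENNReal.rpow_two, ← ENNReal.rpow_mul]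
      norm_num

theorem lintegral_enorm_sq_lt_top {X F : Type*} [MeasurableSpace X] [NormedAddCommGroup F]
    {μ : Measure X} {h : X → F} (hh : MemLp h 2 μ) : ∫⁻ x, ‖h x‖ₑ ^ 2 ∂μ < ⊤ := by
  have := (eLpNorm_lt_top_iff_lintegral_rpow_enorm_lt_top (by simp) (by simp)).1 hh.2
  simpa using this

theorem integrable_norm_sq_of_lintegral {X F : Type*} [MeasurableSpace X] [NormedAddCommGroup F]
    {μ : Measure X} {h : X → F} (hm : AEStronglyMeasurable h μ) (hh : ∫⁻ x, ‖h x‖ₑ ^ 2 ∂μ < ⊤) :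
    Integrable (fun x => ‖h x‖ ^ 2) μ := by
  refine ⟨by fun_prop, ?_⟩
  simpa [HasFiniteIntegral, enorm_pow] using hh

theorem ofReal_integral_norm_sq {X F : Type*} [MeasurableSpace X] [NormedAddCommGroup F]
    {μ : Measure X} {h : X → F} (hi : Integrable (fun x => ‖h x‖ ^ 2) μ) :
    ENNReal.ofReal (∫ x, ‖h x‖ ^ 2 ∂μ) = ∫⁻ x, ‖h x‖ₑ ^ 2 ∂μ := by
  rw [ofReal_integral_eq_lintegral_ofReal hi (ae_of_all _ fun x => by positivity)]
  simp [ENNReal.ofReal_pow]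

/-- Hardy's inequality for `C¹` functions. -/
theorem hardy_of_contDiff {f : E3 → ℝ} (hf : ContDiff ℝ 1 f) (h1 : ∫⁻ x, ‖f x‖ₑ ^ 2 < ⊤)
    (a : E3) :
    ∫⁻ x, ‖f x‖ₑ ^ 2 * ‖x - a‖ₑ⁻¹ ^ 2 ≤ 4 * ∫⁻ x, ‖fderiv ℝ f x‖ₑ ^ 2 := by
  wlog ha : a = 0 generalizing f a
  · have h := this (f := fun x => f (x + a)) (hf.comp (contDiff_id.add contDiff_const))
      (by rwa [lintegral_add_right_eq_self (fun x => ‖f x‖ₑ ^ 2) a]) 0 rfl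
    rw [← lintegral_add_right_eq_self _ a]
    simp only [fderiv_comp_add_right] at h
    rw [lintegral_add_right_eq_self (fun x => ‖fderiv ℝ f x‖ₑ ^ 2) a] at h
    simpa using h
  subst ha
  have hfc := hf.continuous
  have hfc' : Continuous (fderiv ℝ f) := hf.continuous_fderiv one_ne_zero
  by_cases h2 : ∫⁻ x, ‖fderiv ℝ f x‖ₑ ^ 2 = ⊤
  · simp [h2]
  have i1 := integrable_norm_sq_of_lintegral hfc.aestronglyMeasurable h1
  have i2 := integrable_norm_sq_of_lintegral hfc'.aestronglyMeasurable (lt_top_iff_ne_top.2 h2)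
  refine lintegral_le_of_ae_tendsto
    (F := fun n x => ENNReal.ofReal (f x ^ 2 / (‖x‖ ^ 2 + 1 / ((n : ℝ) + 1))))
    (fun n => by fun_prop) (fun n => ?_) ?_
  · have hn : (0 : ℝ) < 1 / ((n : ℝ) + 1) := by positivity
    obtain ⟨hi, hle⟩ := hardy_regularised hf (by simpa using i1) i2 hn
    rw [← ofReal_integral_eq_lintegral_ofReal hi (ae_of_all _ fun x => by positivity),
      ← ofReal_integral_norm_sq i2]
    calc _ ≤ _ := ENNReal.ofReal_le_ofReal hle
      _ = _ := by rw [ENNReal.ofReal_mul (by norm_num)]; norm_num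
  · have h0 : ∀ᵐ x : E3, x ≠ 0 := by simp [ae_iff]
    filter_upwards [h0] with x hx
    have hx' : 0 < ‖x‖ := norm_pos_iff.2 hx
    have hlim : Tendsto (fun n : ℕ => ENNReal.ofReal (f x ^ 2 / (‖x‖ ^ 2 + 1 / ((n : ℝ) + 1))))
        atTop (𝓝 (ENNReal.ofReal (f x ^ 2 / (‖x‖ ^ 2 + 0)))) := by
      refine ENNReal.tendsto_ofReal (Tendsto.div tendsto_const_nhds
        (tendsto_const_nhds.add tendsto_one_div_add_atTop_nhds_zero_nat) (by positivity))
    convert hlim using 2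
    rw [add_zero, ENNReal.ofReal_div_of_pos (by positivity), ENNReal.ofReal_pow hx'.le,
      ofReal_norm, sub_zero, ← ENNReal.inv_pow, ENNReal.div_eq_inv_mul, mul_comm, ← sq_abs,
      ENNReal.ofReal_pow (abs_nonneg _), ← Real.norm_eq_abs, ofReal_norm]

/-! ### Mollification and Hardy's inequality in H¹ -/

/-- Convolution with a probability density contracts the `L²` norm. -/
theorem lintegral_sq_mollify_le {φ : E3 → ℝ} (hφ : Continuous φ) (hφ0 : ∀ x, 0 ≤ φ x)
    (hφ1 : ∫⁻ x, ENNReal.ofReal (φ x) = 1) {h : E3 → ℝ≥0∞} (hh : AEMeasurable h) :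
    ∫⁻ x, (∫⁻ t, ENNReal.ofReal (φ t) * h (x - t)) ^ 2 ≤ ∫⁻ x, h x ^ 2 := by
  have hsub : ∀ x : E3, AEMeasurable fun t => h (x - t) := fun x =>
    hh.comp_quasiMeasurePreserving (quasiMeasurePreserving_sub_left volume x)
  have hprod : AEMeasurable (fun p : E3 × E3 => h (p.1 - p.2)) (volume.prod volume) :=
    hh.comp_quasiMeasurePreserving (quasiMeasurePreserving_sub volume volume)
  calc _ ≤ ∫⁻ x, ∫⁻ t, ENNReal.ofReal (φ t) * h (x - t) ^ 2 := by
        refine lintegral_mono fun x => ?_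
        -- Jensen's inequality, obtained from Cauchy–Schwarz by writing φh = √φ · (√φ h) and using
        -- ∫φ = 1.
        have := sq_lintegral_mul_le (μ := volume) (f := fun t => ENNReal.ofReal √(φ t))
          (g := fun t => ENNReal.ofReal √(φ t) * h (x - t)) (by fun_prop)
          (AEMeasurable.mul (by fun_prop) (hsub x))
        simp only [← mul_assoc, mul_pow, ← ENNReal.ofReal_mul (Real.sqrt_nonneg _),
          Real.mul_self_sqrt (hφ0 _), ← ENNReal.ofReal_pow (Real.sqrt_nonneg _),
          Real.sq_sqrt (hφ0 _), hφ1, one_mul] at this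
        exact this
    _ = ∫⁻ t, ∫⁻ x, ENNReal.ofReal (φ t) * h (x - t) ^ 2 := by
        refine lintegral_lintegral_swap ?_
        exact AEMeasurable.mul (by fun_prop) (hprod.pow_const 2)
    _ = ∫⁻ t, ENNReal.ofReal (φ t) * ∫⁻ x, h x ^ 2 := by
        refine lintegral_congr fun t => ?_
        rw [lintegral_const_mul' _ _ (by simp),
          lintegral_sub_right_eq_self (fun x => h x ^ 2) t]
    _ = _ := by rw [lintegral_mul_const _ (by fun_prop), hφ1, one_mul]

open scoped Convolution in
-- The derivative falls on φ, and y ↦ φ(x − y) is an admissible test function, so the weak gradient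
-- moves it onto u.
theorem fderiv_mollify_apply {u : E3 → ℝ} {v : E3 → E3} (hu : LocallyIntegrable u)
    (huv : IsWeakGradient u v) {φ : E3 → ℝ} (hφ : ContDiff ℝ ∞ φ) (hc : HasCompactSupport φ)
    (x e : E3) :
    fderiv ℝ (φ ⋆[ContinuousLinearMap.lsmul ℝ ℝ, volume] u) x e
      = ∫ t, φ t * inner ℝ (v (x - t)) e := by
  rw [← convolution_flip, (hc.hasFDerivAt_convolution_right
    (ContinuousLinearMap.lsmul ℝ ℝ).flip hu (hφ.of_le (by simp)) x).fderiv,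
    convolution_precompR_apply _ hu (hc.fderiv ℝ) (hφ.continuous_fderiv (by simp))]
  have hd : ∀ y, fderiv ℝ (fun y => φ (x - y)) y = - fderiv ℝ φ (x - y) := fun y => by
    have h := ((hφ.differentiable (by simp)) (x - y)).hasFDerivAt.comp y
      ((hasFDerivAt_id y).const_sub x)
    refine h.fderiv.trans ?_
    ext z
    simp
  have h := huv (fun y => φ (x - y)) (hφ.comp (contDiff_const.sub contDiff_id))
    (hc.comp_homeomorph (Homeomorph.subLeft x)) e
  simp only [hd, neg_apply, mul_neg, integral_neg, neg_inj] at h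
  rw [← integral_sub_left_eq_self _ _ x]
  simp only [sub_sub_cancel, convolution_def, ContinuousLinearMap.flip_apply,
    ContinuousLinearMap.lsmul_apply, smul_eq_mul]
  simp only [mul_comm] at h ⊢
  exact h

open scoped Convolution in
/-- Hardy's inequality for weakly differentiable functions. -/
theorem IsWeakGradient.hardy {u : E3 → ℝ} {v : E3 → E3} (hu : MemLp u 2) (hv : MemLp v 2)
    (huv : IsWeakGradient u v) :
    ∫⁻ x, ‖u x‖ₑ ^ 2 * ‖x‖ₑ⁻¹ ^ 2 ≤ 4 * ∫⁻ x, ‖v x‖ₑ ^ 2 := by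
  have huL : LocallyIntegrable u := hu.locallyIntegrable (by norm_num)
  let B : ℕ → ContDiffBump (0 : E3) := fun n =>
    ⟨1 / ((n : ℝ) + 1), 2 * (1 / ((n : ℝ) + 1)), by positivity,
      by have : (0 : ℝ) < 1 / ((n : ℝ) + 1) := by positivity
         linarith⟩
  let φ : ℕ → E3 → ℝ := fun n => (B n).normed volume
  let U : ℕ → E3 → ℝ := fun n => φ n ⋆[ContinuousLinearMap.lsmul ℝ ℝ, volume] u
  have hφs : ∀ n, ContDiff ℝ ∞ (φ n) := fun n => (B n).contDiff_normed
  have hφc : ∀ n, HasCompactSupport (φ n) := fun n => (B n).hasCompactSupport_normed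
  have hφ0 : ∀ n x, 0 ≤ φ n x := fun n x => (B n).nonneg_normed x
  have hφ1 : ∀ n, ∫⁻ x, ENNReal.ofReal (φ n x) = 1 := fun n => by
    rw [← ofReal_integral_eq_lintegral_ofReal (B n).integrable_normed (ae_of_all _ (hφ0 n)),
      (B n).integral_normed, ENNReal.ofReal_one]
  have hUs : ∀ n, ContDiff ℝ 1 (U n) := fun n =>
    HasCompactSupport.contDiff_convolution_left (n := 1) _ (hφc n) ((hφs n).of_le (by simp)) huL
  have hUb : ∀ n x, ‖U n x‖ₑ ≤ ∫⁻ t, ENNReal.ofReal (φ n t) * ‖u (x - t)‖ₑ := fun n x => by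
    refine (enorm_integral_le_lintegral_enorm _).trans (le_of_eq (lintegral_congr fun t => ?_))
    rw [ContinuousLinearMap.lsmul_apply, enorm_smul, Real.enorm_of_nonneg (hφ0 n t)]
  have hDb : ∀ n x, ‖fderiv ℝ (U n) x‖ₑ ≤ ∫⁻ t, ENNReal.ofReal (φ n t) * ‖v (x - t)‖ₑ := by
    intro n x
    refine ContinuousLinearMap.opENorm_le_bound _ fun e => ?_
    rw [fderiv_mollify_apply huL huv (hφs n) (hφc n)]
    refine (enorm_integral_le_lintegral_enorm _).trans ?_
    rw [← lintegral_mul_const' _ _ (by simp)]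
    refine lintegral_mono fun t => ?_
    rw [enorm_mul, Real.enorm_of_nonneg (hφ0 n t), mul_assoc]
    gcongr
    rw [← ofReal_norm, ← ofReal_norm, ← ofReal_norm, ← ENNReal.ofReal_mul (norm_nonneg _)]
    exact ENNReal.ofReal_le_ofReal (norm_inner_le_norm _ _)
  have hU2 : ∀ n, ∫⁻ x, ‖U n x‖ₑ ^ 2 ≤ ∫⁻ x, ‖u x‖ₑ ^ 2 := fun n =>
    (lintegral_mono fun x => pow_le_pow_left' (hUb n x) 2).trans
      (lintegral_sq_mollify_le (hφs n).continuous (hφ0 n) (hφ1 n) hu.1.enorm)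
  have hD2 : ∀ n, ∫⁻ x, ‖fderiv ℝ (U n) x‖ₑ ^ 2 ≤ ∫⁻ x, ‖v x‖ₑ ^ 2 := fun n =>
    (lintegral_mono fun x => pow_le_pow_left' (hDb n x) 2).trans
      (lintegral_sq_mollify_le (hφs n).continuous (hφ0 n) (hφ1 n) hv.1.enorm)
  -- The outer radius of each bump is twice its inner radius; this bounded ratio is what almost
  -- everywhere convergence requires.
  have hlim : ∀ᵐ x, Tendsto (fun n => U n x) atTop (𝓝 (u x)) := by
    refine ContDiffBump.ae_convolution_tendsto_right_of_locallyIntegrable (K := 2) ?_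
      (Eventually.of_forall fun n => le_rfl) huL
    have := (tendsto_one_div_add_atTop_nhds_zero_nat (𝕜 := ℝ)).const_mul 2
    simpa [B] using this
  have h0 : ∀ᵐ x : E3, x ≠ 0 := by simp [ae_iff]
  refine lintegral_le_of_ae_tendsto (F := fun n x => ‖U n x‖ₑ ^ 2 * ‖x‖ₑ⁻¹ ^ 2) (fun n => ?_)
    (fun n => ?_) ?_
  · have := (hUs n).continuous
    fun_prop
  · have := hardy_of_contDiff (hUs n) ((hU2 n).trans_lt (lintegral_enorm_sq_lt_top hu)) 0
    simp only [sub_zero] at this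
    exact this.trans (mul_le_mul_right (hD2 n) 4)
  · filter_upwards [hlim, h0] with x hx hx0
    refine ENNReal.Tendsto.mul_const ((ENNReal.continuous_pow 2).continuousAt.tendsto.comp
      ((continuous_enorm.tendsto _).comp hx)) (Or.inr ?_)
    simp [hx0]

theorem lintegral_inv_norm_sq_le (ρ : Measure E3) :
    ∫⁻ x, ‖x‖ₑ⁻¹ ^ 2 ∂ρ ≤ 4 * kinetic ρ := by
  simp only [kinetic, ENNReal.mul_iInf_of_ne (show (4 : ℝ≥0∞) ≠ 0 by norm_num)
    (show (4 : ℝ≥0∞) ≠ ⊤ by norm_num)]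
  refine le_iInf fun u => le_iInf fun v => le_iInf fun hu0 => le_iInf fun hu => le_iInf fun hv =>
    le_iInf fun huv => le_iInf fun hρ => ?_
  rw [hρ, lintegral_withDensity_eq_lintegral_mul₀ (by have := hu.1.aemeasurable; fun_prop)
    (by fun_prop)]
  refine le_trans (le_of_eq (lintegral_congr fun x => ?_)) (huv.hardy hu hv)
  rw [Pi.mul_apply, ENNReal.ofReal_pow (hu0 x), Real.enorm_of_nonneg (hu0 x)]

/-- Cauchy–Schwarz against ρ, then Hardy. On the whole space it bounds the potential by the kinetic
energy; on a ball it shows that little mass carries little potential. -/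
theorem sq_setLIntegral_inv_norm_le (ρ : Measure E3) (s : Set E3) :
    (∫⁻ x in s, ‖x‖ₑ⁻¹ ∂ρ) ^ 2 ≤ 4 * (ρ s * kinetic ρ) := by
  have h := sq_lintegral_mul_le (μ := ρ.restrict s) (f := fun _ => 1) (g := fun x => ‖x‖ₑ⁻¹)
    (by fun_prop) (by fun_prop)
  simp only [one_mul, one_pow, lintegral_one, Measure.restrict_apply_univ] at h
  calc _ ≤ _ := h
    _ ≤ ρ s * (4 * kinetic ρ) := by
      gcongr
      exact (setLIntegral_le_lintegral _ _).trans (lintegral_inv_norm_sq_le ρ)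
    _ = _ := by ring

/-! ### Calculus of weak gradients -/

theorem inner_gradient_eq (f : E3 → ℝ) (x e : E3) : inner ℝ (gradient f x) e = fderiv ℝ f x e :=
  InnerProductSpace.toDual_symm_apply

theorem norm_gradient_eq (f : E3 → ℝ) (x : E3) : ‖gradient f x‖ = ‖fderiv ℝ f x‖ :=
  LinearIsometryEquiv.norm_map _ _

theorem continuous_gradient {f : E3 → ℝ} (hf : ContDiff ℝ ∞ f) : Continuous (gradient f) :=
  (LinearIsometryEquiv.continuous _).comp (hf.continuous_fderiv (by simp))

theorem integrable_mul_of_hasCompactSupport {u φ : E3 → ℝ} (hu : LocallyIntegrable u)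
    (hφ : Continuous φ) (hc : HasCompactSupport φ) : Integrable fun x => u x * φ x :=
  hu.integrable_smul_right_of_hasCompactSupport hφ hc

theorem integrable_inner_mul_of_hasCompactSupport {v : E3 → E3} {φ : E3 → ℝ}
    (hv : LocallyIntegrable v) (hφ : Continuous φ) (hc : HasCompactSupport φ) (e : E3) :
    Integrable fun x => inner ℝ (v x) e * φ x := by
  have h := (hv.integrable_smul_left_of_hasCompactSupport hφ hc).inner_const (𝕜 := ℝ) e
  refine h.congr (ae_of_all _ fun x => ?_)
  simp [inner_smul_left, mul_comm]

theorem continuous_fderiv_apply_const {φ : E3 → ℝ} (hφ : ContDiff ℝ ∞ φ) (e : E3) :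
    Continuous fun x => fderiv ℝ φ x e :=
  (hφ.continuous_fderiv (by simp)).clm_apply continuous_const

/-- Test the weak gradient of u against ζφ; the term containing the derivative of ζ moves to the
other side. -/
theorem IsWeakGradient.mul_left {u : E3 → ℝ} {v : E3 → E3} (huv : IsWeakGradient u v)
    (hu : LocallyIntegrable u) (hv : LocallyIntegrable v) {ζ : E3 → ℝ} (hζ : ContDiff ℝ ∞ ζ) :
    IsWeakGradient (fun x => ζ x * u x) (fun x => ζ x • v x + u x • gradient ζ x) := by
  intro φ hφ hc e
  have h := huv (fun x => ζ x * φ x) (hζ.mul hφ) hc.mul_left e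
  have hd : ∀ x, fderiv ℝ (fun x => ζ x * φ x) x e = ζ x * fderiv ℝ φ x e + fderiv ℝ ζ x e * φ x := by
    intro x
    rw [fderiv_fun_mul (hζ.differentiable (by simp) x) (hφ.differentiable (by simp) x)]
    simp [mul_comm]
  have i1 : Integrable fun x => u x * (ζ x * fderiv ℝ φ x e) :=
    integrable_mul_of_hasCompactSupport hu
      (hζ.continuous.mul (continuous_fderiv_apply_const hφ e)) (hc.fderiv_apply ℝ e).mul_left
  have i2 : Integrable fun x => u x * (fderiv ℝ ζ x e * φ x) :=
    integrable_mul_of_hasCompactSupport hu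
      ((continuous_fderiv_apply_const hζ e).mul hφ.continuous) hc.mul_left
  have i3 : Integrable fun x => inner ℝ (v x) e * (ζ x * φ x) :=
    integrable_inner_mul_of_hasCompactSupport hv (hζ.continuous.mul hφ.continuous) hc.mul_left e
  simp only [hd, mul_add] at h
  rw [integral_add i1 i2] at h
  have e1 : ∫ x, ζ x * u x * fderiv ℝ φ x e = ∫ x, u x * (ζ x * fderiv ℝ φ x e) :=
    integral_congr_ae (ae_of_all _ fun x => by ring)
  have e2 : ∫ x, inner ℝ (ζ x • v x + u x • gradient ζ x) e * φ x
      = (∫ x, inner ℝ (v x) e * (ζ x * φ x)) + ∫ x, u x * (fderiv ℝ ζ x e * φ x) := by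
    rw [← integral_add i3 i2]
    refine integral_congr_ae (ae_of_all _ fun x => ?_)
    simp only [inner_add_left, inner_smul_left, inner_gradient_eq]
    simp only [conj_trivial]
    ring
  rw [e1, e2]
  linarith

theorem isWeakGradient_gradient {w : E3 → ℝ} (hw : ContDiff ℝ ∞ w) :
    IsWeakGradient w (gradient w) := by
  intro φ hφ hc e
  simp only [inner_gradient_eq]
  have hwc := hw.continuous
  have hφc := hφ.continuous
  have hwd := continuous_fderiv_apply_const hw e
  have hφd := continuous_fderiv_apply_const hφ e
  exact integral_mul_fderiv_eq_neg_fderiv_mul_of_integrable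
    ((hwd.mul hφc).integrable_of_hasCompactSupport hc.mul_left)
    ((hwc.mul hφd).integrable_of_hasCompactSupport (hc.fderiv_apply ℝ e).mul_left)
    ((hwc.mul hφc).integrable_of_hasCompactSupport hc.mul_left)
    (fun x _ => hw.differentiable (by simp) x) (fun x _ => hφ.differentiable (by simp) x)

theorem IsWeakGradient.add {u₁ u₂ : E3 → ℝ} {v₁ v₂ : E3 → E3} (h₁ : IsWeakGradient u₁ v₁)
    (h₂ : IsWeakGradient u₂ v₂) (hu₁ : LocallyIntegrable u₁) (hu₂ : LocallyIntegrable u₂)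
    (hv₁ : LocallyIntegrable v₁) (hv₂ : LocallyIntegrable v₂) :
    IsWeakGradient (fun x => u₁ x + u₂ x) (fun x => v₁ x + v₂ x) := by
  intro φ hφ hc e
  have hφd := continuous_fderiv_apply_const hφ e
  simp only [inner_add_left, add_mul]
  rw [integral_add (integrable_mul_of_hasCompactSupport hu₁ hφd (hc.fderiv_apply ℝ e))
    (integrable_mul_of_hasCompactSupport hu₂ hφd (hc.fderiv_apply ℝ e)),
    integral_add (integrable_inner_mul_of_hasCompactSupport hv₁ hφ.continuous hc e)
    (integrable_inner_mul_of_hasCompactSupport hv₂ hφ.continuous hc e),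
    h₁ φ hφ hc e, h₂ φ hφ hc e]
  ring

theorem kinetic_le {ρ : Measure E3} {u : E3 → ℝ} {v : E3 → E3} (hu0 : ∀ x, 0 ≤ u x)
    (hu : MemLp u 2) (hv : MemLp v 2) (huv : IsWeakGradient u v)
    (hρ : ρ = volume.withDensity fun x => ENNReal.ofReal (u x ^ 2)) :
    kinetic ρ ≤ ∫⁻ x, ‖v x‖ₑ ^ 2 := by
  rw [kinetic]
  exact iInf_le_of_le u <| iInf_le_of_le v <| iInf_le_of_le hu0 <| iInf_le_of_le hu <|
    iInf_le_of_le hv <| iInf_le_of_le huv <| iInf_le_of_le hρ le_rfl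

/-! ### Relocation of mass and its kinetic cost -/

/-- The measure obtained from `ρ` by keeping the fraction `ζ²` of the mass in place and
redistributing the rest according to `ν`. -/
noncomputable def relocate (ρ : Measure E3) (ζ : E3 → ℝ) (ν : Measure E3) : Measure E3 :=
  ρ.withDensity (fun x => ENNReal.ofReal (ζ x ^ 2))
    + (∫⁻ x, ENNReal.ofReal (1 - ζ x ^ 2) ∂ρ) • ν

theorem lintegral_one_sub_sq_le_one (ρ : Measure E3) [IsProbabilityMeasure ρ] (ζ : E3 → ℝ) :
    ∫⁻ x, ENNReal.ofReal (1 - ζ x ^ 2) ∂ρ ≤ 1 := by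
  calc _ ≤ ∫⁻ _, 1 ∂ρ := lintegral_mono fun x => by
        rw [← ENNReal.ofReal_one]
        exact ENNReal.ofReal_le_ofReal (by nlinarith [sq_nonneg (ζ x)])
    _ = 1 := by simp

theorem isProbabilityMeasure_relocate (ρ ν : Measure E3) [IsProbabilityMeasure ρ]
    [IsProbabilityMeasure ν] {ζ : E3 → ℝ} (hζ : Measurable ζ) (h0 : ∀ x, 0 ≤ ζ x)
    (h1 : ∀ x, ζ x ≤ 1) : IsProbabilityMeasure (relocate ρ ζ ν) := by
  constructor
  simp only [relocate, Measure.add_apply, Measure.smul_apply, measure_univ, smul_eq_mul, mul_one,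
    withDensity_apply _ MeasurableSet.univ, Measure.restrict_univ]
  rw [← lintegral_add_left (by fun_prop)]
  calc _ = ∫⁻ _, 1 ∂ρ := lintegral_congr fun x => by
        rw [← ENNReal.ofReal_add (sq_nonneg _)
          (sub_nonneg.2 (pow_le_one₀ (h0 x) (h1 x)))]
        simp
    _ = 1 := by simp

/-- Young's inequality on the cross term. The small weight θ goes to the original gradient, and the
price 1/θ falls on the cutoff gradients, which can be made small afterwards. -/
theorem norm_add_sq_le {θ : ℝ} (hθ : 0 < θ) {a b c d : E3} (hb : ‖b‖ ≤ ‖a‖) :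
    ‖b + c + d‖ ^ 2 ≤ (1 + θ) * ‖a‖ ^ 2 + 2 * (1 + 1 / θ) * (‖c‖ ^ 2 + ‖d‖ ^ 2) := by
  have h : ‖b + c + d‖ ≤ ‖a‖ + (‖c‖ + ‖d‖) := by
    have := norm_add₃_le (a := b) (b := c) (c := d)
    linarith
  have h2 : ‖b + c + d‖ ^ 2 ≤ (‖a‖ + (‖c‖ + ‖d‖)) ^ 2 := by gcongr
  have h3 : 2 * (‖a‖ * (‖c‖ + ‖d‖)) ≤ θ * ‖a‖ ^ 2 + 1 / θ * (‖c‖ + ‖d‖) ^ 2 := by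
    have : θ * ‖a‖ ^ 2 + 1 / θ * (‖c‖ + ‖d‖) ^ 2 - 2 * (‖a‖ * (‖c‖ + ‖d‖))
        = 1 / θ * (θ * ‖a‖ - (‖c‖ + ‖d‖)) ^ 2 := by field_simp; ring
    have : 0 ≤ 1 / θ * (θ * ‖a‖ - (‖c‖ + ‖d‖)) ^ 2 := by positivity
    linarith
  have h4 : (1 + 1 / θ) * (‖c‖ + ‖d‖) ^ 2 ≤ (1 + 1 / θ) * (2 * (‖c‖ ^ 2 + ‖d‖ ^ 2)) := by
    gcongr
    nlinarith [sq_nonneg (‖c‖ - ‖d‖)]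
  nlinarith

theorem exists_norm_fderiv_le {ζ : E3 → ℝ} (hζ : ContDiff ℝ ∞ ζ) (hc : HasCompactSupport ζ) :
    ∃ D, ∀ x, ‖fderiv ℝ ζ x‖ ≤ D :=
  (hζ.continuous_fderiv (by simp)).bounded_above_of_compact_support (hc.fderiv ℝ)

/-- The root of the relocated density is ζu + a·w, where a² is the removed mass, and its weak
gradient is ζv + u∇ζ + a∇w. -/
theorem kinetic_relocate_le (ρ : Measure E3) [IsProbabilityMeasure ρ] {ζ w : E3 → ℝ}
    (hζ : ContDiff ℝ ∞ ζ) (hζc : HasCompactSupport ζ) (h0 : ∀ x, 0 ≤ ζ x) (h1 : ∀ x, ζ x ≤ 1)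
    (hw : ContDiff ℝ ∞ w) (hwc : HasCompactSupport w) (hw0 : ∀ x, 0 ≤ w x)
    (hζw : ∀ x, ζ x * w x = 0) {θ : ℝ} (hθ : 0 < θ) :
    kinetic (relocate ρ ζ (volume.withDensity fun x => ENNReal.ofReal (w x ^ 2)))
      ≤ ENNReal.ofReal (1 + θ) * kinetic ρ + ENNReal.ofReal (2 * (1 + 1 / θ))
        * (∫⁻ x, ‖fderiv ℝ ζ x‖ₑ ^ 2 ∂ρ + ∫⁻ x, ‖fderiv ℝ w x‖ₑ ^ 2) := by
  have hθ1 : ENNReal.ofReal (1 + θ) ≠ 0 := by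
    simp only [ne_eq, ENNReal.ofReal_eq_zero]; linarith
  conv_rhs => rw [kinetic]
  simp only [ENNReal.mul_iInf_of_ne hθ1 ENNReal.ofReal_ne_top, ENNReal.iInf_add]
  refine le_iInf fun u => le_iInf fun v => le_iInf fun hu0 => le_iInf fun hu => le_iInf fun hv =>
    le_iInf fun huv => le_iInf fun hρ => ?_
  set m : ℝ≥0∞ := ∫⁻ x, ENNReal.ofReal (1 - ζ x ^ 2) ∂ρ with hm
  have hm1 : m ≤ 1 := lintegral_one_sub_sq_le_one ρ ζ
  have hmt : m ≠ ⊤ := (hm1.trans_lt ENNReal.one_lt_top).ne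
  set a : ℝ := √m.toReal with ha
  have ha0 : 0 ≤ a := Real.sqrt_nonneg _
  have ha2 : a ^ 2 = m.toReal := Real.sq_sqrt ENNReal.toReal_nonneg
  have ha1 : a ≤ 1 := Real.sqrt_le_one.2 (ENNReal.toReal_le_of_le_ofReal zero_le_one (by simpa))
  obtain ⟨D, hD⟩ := exists_norm_fderiv_le hζ hζc
  have hg := continuous_gradient hζ
  have haw : ContDiff ℝ ∞ fun x => a * w x := contDiff_const.mul hw
  have hawc : HasCompactSupport fun x => a * w x := hwc.mul_left
  have hfd : ∀ x, fderiv ℝ (fun x => a * w x) x = a • fderiv ℝ w x := fun x => by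
    simpa using fderiv_const_mul (hw.differentiable (by simp) x) a
  have hζm := hζ.continuous.aestronglyMeasurable (μ := (volume : Measure E3))
  have m1 : MemLp (fun x => ζ x * u x) 2 := by
    refine hu.of_le_mul (c := 1) (hζm.mul hu.1) (ae_of_all _ fun x => ?_)
    rw [norm_mul, Real.norm_of_nonneg (h0 x)]
    exact mul_le_mul_of_nonneg_right (h1 x) (norm_nonneg _)
  have m2 : MemLp (fun x => ζ x • v x) 2 := by
    refine hv.of_le_mul (c := 1) (hζm.smul hv.1) (ae_of_all _ fun x => ?_)
    rw [norm_smul, Real.norm_of_nonneg (h0 x)]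
    exact mul_le_mul_of_nonneg_right (h1 x) (norm_nonneg _)
  have m3 : MemLp (fun x => u x • gradient ζ x) 2 := by
    refine hu.of_le_mul (c := D) (hu.1.smul hg.aestronglyMeasurable) (ae_of_all _ fun x => ?_)
    rw [norm_smul, norm_gradient_eq, mul_comm]
    exact mul_le_mul_of_nonneg_right (hD x) (norm_nonneg _)
  have m4 : MemLp (fun x => a * w x) 2 (volume : Measure E3) :=
    haw.continuous.memLp_of_hasCompactSupport hawc
  have m5 : MemLp (gradient fun x => a * w x) 2 (volume : Measure E3) :=
    (continuous_gradient haw).memLp_of_hasCompactSupport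
      ((hawc.fderiv ℝ).comp_left (map_zero _))
  have hle : (1 : ℝ≥0∞) ≤ 2 := by norm_num
  have hnn : ∀ x, 0 ≤ ζ x * u x + a * w x := fun x =>
    add_nonneg (mul_nonneg (h0 x) (hu0 x)) (mul_nonneg ha0 (hw0 x))
  have hweak := (huv.mul_left (hu.locallyIntegrable hle) (hv.locallyIntegrable hle) hζ).add
    (isWeakGradient_gradient haw) (m1.locallyIntegrable hle) (m4.locallyIntegrable hle)
    ((m2.add m3).locallyIntegrable hle) (m5.locallyIntegrable hle)
  have hmeas : relocate ρ ζ (volume.withDensity fun x => ENNReal.ofReal (w x ^ 2))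
      = volume.withDensity fun x => ENNReal.ofReal ((ζ x * u x + a * w x) ^ 2) := by
    have hum := hu.1.aemeasurable
    have hzc := hζ.continuous
    have hwcont := hw.continuous
    have hsq : (fun x => ENNReal.ofReal ((ζ x * u x + a * w x) ^ 2))
        = ((fun x => ENNReal.ofReal (u x ^ 2)) * fun x => ENNReal.ofReal (ζ x ^ 2))
          + (m • fun x => ENNReal.ofReal (w x ^ 2)) := by
      ext x
      have : (ζ x * u x + a * w x) ^ 2 = u x ^ 2 * ζ x ^ 2 + m.toReal * w x ^ 2 := by
        rw [← ha2]
        -- The cross term vanishes because ζw = 0.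
        linear_combination 2 * a * u x * hζw x
      rw [this, ENNReal.ofReal_add (by positivity) (by positivity),
        ENNReal.ofReal_mul (by positivity), ENNReal.ofReal_mul (by positivity),
        ENNReal.ofReal_toReal hmt]
      rfl
    rw [hsq, withDensity_add_right _ (by fun_prop), withDensity_mul₀ (by fun_prop) (by fun_prop),
      withDensity_smul' _ _ hmt, ← hρ, relocate]
  refine (kinetic_le hnn (m1.add m4) ((m2.add m3).add m5) hweak hmeas).trans ?_
  have hζρ : ∫⁻ x, ‖fderiv ℝ ζ x‖ₑ ^ 2 ∂ρ = ∫⁻ x, ‖u x • gradient ζ x‖ₑ ^ 2 := by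
    have hum := hu.1.aemeasurable
    have hzd := hζ.continuous_fderiv (by simp)
    rw [hρ, lintegral_withDensity_eq_lintegral_mul₀ (by fun_prop) (by fun_prop)]
    refine lintegral_congr fun x => ?_
    rw [Pi.mul_apply, enorm_smul, mul_pow, ENNReal.ofReal_pow (hu0 x),
      Real.enorm_of_nonneg (hu0 x), ← ofReal_norm (gradient ζ x), norm_gradient_eq, ofReal_norm]
  have hm3 : AEMeasurable (fun x => ‖u x • gradient ζ x‖ₑ ^ 2) := m3.1.enorm.pow_const 2
  have hm2 : AEMeasurable (fun x => ENNReal.ofReal (1 + θ) * ‖v x‖ₑ ^ 2) :=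
    (hv.1.enorm.pow_const 2).const_mul _
  rw [hζρ, ← lintegral_add_left' hm3, ← lintegral_const_mul' _ _ ENNReal.ofReal_ne_top,
    ← lintegral_const_mul' _ _ ENNReal.ofReal_ne_top, ← lintegral_add_left' hm2]
  refine lintegral_mono fun x => ?_
  simp only [Pi.add_apply, ← ofReal_norm]
  rw [← ENNReal.ofReal_pow (norm_nonneg _), ← ENNReal.ofReal_pow (norm_nonneg _),
    ← ENNReal.ofReal_pow (norm_nonneg _), ← ENNReal.ofReal_pow (norm_nonneg _),
    ← ENNReal.ofReal_add (by positivity) (by positivity), ← ENNReal.ofReal_mul (by positivity),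
    ← ENNReal.ofReal_mul (by positivity), ← ENNReal.ofReal_add (by positivity) (by positivity)]
  refine ENNReal.ofReal_le_ofReal ?_
  have hb : ‖ζ x • v x‖ ≤ ‖v x‖ := by
    rw [norm_smul, Real.norm_of_nonneg (h0 x)]
    exact mul_le_of_le_one_left (norm_nonneg _) (h1 x)
  refine (norm_add_sq_le hθ hb).trans ?_
  gcongr
  rw [norm_gradient_eq, hfd, norm_smul, Real.norm_of_nonneg ha0]
  exact mul_le_of_le_one_left (norm_nonneg _) ha1

/-! ### Flat densities far from the origin -/

theorem lintegral_comp_smul (F : E3 → ℝ≥0∞) {r : ℝ} (hr : 0 < r) :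
    ∫⁻ x, F (r • x) = ENNReal.ofReal (r⁻¹ ^ 3) * ∫⁻ x, F x := by
  have h := lintegral_map_equiv (μ := (volume : Measure E3)) F (MeasurableEquiv.smul₀ r hr.ne')
  rw [MeasurableEquiv.coe_smul₀, Measure.map_addHaar_smul _ hr.ne'] at h
  rw [← h, lintegral_smul_measure, smul_eq_mul]
  simp [abs_of_pos hr]

/-- Far away there are normalised smooth profiles with arbitrarily small kinetic energy. -/
theorem exists_far_bump (r : ℝ) {κ : ℝ} (hκ : 0 < κ) :
    ∃ w : E3 → ℝ, ContDiff ℝ ∞ w ∧ HasCompactSupport w ∧ (∀ x, 0 ≤ w x) ∧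
      ∫⁻ x, ENNReal.ofReal (w x ^ 2) = 1 ∧ (∀ x ∈ Metric.ball (0 : E3) r, w x = 0) ∧
      ∫⁻ x, ‖fderiv ℝ w x‖ₑ ^ 2 ≤ ENNReal.ofReal κ := by
  -- The centre is at distance 3 and the outer radius is 2, so ψ vanishes on the unit ball and its
  -- dilation by L ≥ r vanishes on the ball of radius r.
  let ψ : ContDiffBump (EuclideanSpace.single (0 : Fin 3) (3 : ℝ)) := ⟨1, 2, by norm_num, by norm_num⟩
  have hψs : ContDiff ℝ ∞ ψ := ψ.contDiff
  have hψd : Continuous (fderiv ℝ ψ) := hψs.continuous_fderiv (by simp)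
  have hψ2 : HasCompactSupport fun x => ψ x ^ 2 :=
    ψ.hasCompactSupport.comp_left (g := fun t : ℝ => t ^ 2) (by simp)
  have iA : Integrable fun x => ψ x ^ 2 :=
    (ψ.continuous.pow 2).integrable_of_hasCompactSupport hψ2
  have iD : Integrable fun x => ‖fderiv ℝ ψ x‖ ^ 2 :=
    (hψd.norm.pow 2).integrable_of_hasCompactSupport
      (by simpa [pow_two] using (ψ.hasCompactSupport.fderiv ℝ).norm.mul_left)
  set A := ∫ x, ψ x ^ 2 with hA
  set D := ∫ x, ‖fderiv ℝ ψ x‖ ^ 2 with hD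
  have hA0 : 0 < A := by
    refine (ψ.continuous.pow 2).integral_pos_of_hasCompactSupport_nonneg_nonzero
      hψ2 (fun x => sq_nonneg _)
      (x := EuclideanSpace.single (0 : Fin 3) (3 : ℝ)) ?_
    have := ψ.pos_of_mem_ball (x := EuclideanSpace.single (0 : Fin 3) (3 : ℝ)) (by simp [ψ])
    exact (pow_pos this 2).ne'
  have hD0 : 0 ≤ D := integral_nonneg fun x => by positivity
  -- The normalised dilation has kinetic energy D/(A L²); since L ≥ 1 gives L ≤ L², the bound D/(Aκ)
  -- ≤ L suffices.
  obtain ⟨L, hLr, hL1, hLκ⟩ : ∃ L : ℝ, r ≤ L ∧ 1 ≤ L ∧ D / (A * κ) ≤ L :=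
    ⟨max r (max 1 (D / (A * κ))), by simp, by simp, by simp⟩
  have hL0 : 0 < L := by linarith
  have hLi : 0 < L⁻¹ := inv_pos.2 hL0
  -- Normalisation: the dilated ψ² has integral A L³.
  set a : ℝ := √(A⁻¹ * L⁻¹ ^ 3) with ha
  have ha2 : a ^ 2 = A⁻¹ * L⁻¹ ^ 3 := Real.sq_sqrt (by positivity)
  have ha0 : 0 ≤ a := Real.sqrt_nonneg _
  have hcomp : ContDiff ℝ ∞ fun x : E3 => ψ (L⁻¹ • x) := hψs.comp (contDiff_const_smul _)
  refine ⟨fun x => a * ψ (L⁻¹ • x), contDiff_const.mul hcomp, ?_,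
    fun x => mul_nonneg ha0 ψ.nonneg, ?_, fun x hx => ?_, ?_⟩
  · exact (ψ.hasCompactSupport.comp_homeomorph (Homeomorph.smulOfNeZero L⁻¹ hLi.ne')).mul_left
  · rw [lintegral_comp_smul (fun x => ENNReal.ofReal ((a * ψ x) ^ 2)) hLi]
    simp only [mul_pow, ENNReal.ofReal_mul (sq_nonneg a)]
    rw [lintegral_const_mul' _ _ ENNReal.ofReal_ne_top,
      ← ofReal_integral_eq_lintegral_ofReal iA (ae_of_all _ fun x => sq_nonneg _),
      ← ENNReal.ofReal_mul (sq_nonneg a), ← ENNReal.ofReal_mul (by positivity), ← hA, ha2,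
      ← ENNReal.ofReal_one]
    congr 1
    field_simp
  · have : ψ (L⁻¹ • x) = 0 := by
      refine ψ.zero_of_le_dist ?_
      have h1 : ‖L⁻¹ • x‖ ≤ 1 := by
        rw [norm_smul, Real.norm_of_nonneg hLi.le, inv_mul_le_one₀ hL0]
        exact (mem_ball_zero_iff.1 hx).le.trans hLr
      have h2 : ‖EuclideanSpace.single (0 : Fin 3) (3 : ℝ)‖ = 3 := by simp
      have h3 := norm_sub_norm_le (EuclideanSpace.single (0 : Fin 3) (3 : ℝ)) (L⁻¹ • x)
      rw [dist_comm, dist_eq_norm]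
      change (2 : ℝ) ≤ _
      linarith
    simp [this]
  · have hfd : ∀ x, fderiv ℝ (fun x => a * ψ (L⁻¹ • x)) x = (a * L⁻¹) • fderiv ℝ ψ (L⁻¹ • x) := by
      intro x
      have := fderiv_const_mul (hcomp.differentiable (by simp) x) a
      rw [this, fderiv_comp_smul, smul_smul]
    simp only [hfd]
    rw [lintegral_comp_smul (fun x => ‖(a * L⁻¹) • fderiv ℝ ψ x‖ₑ ^ 2) hLi]
    simp only [enorm_smul, mul_pow]
    rw [lintegral_const_mul' _ _ (ENNReal.pow_ne_top enorm_ne_top), ← ofReal_integral_norm_sq iD,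
      Real.enorm_of_nonneg (by positivity), ← ENNReal.ofReal_pow (by positivity),
      ← ENNReal.ofReal_mul (by positivity), ← ENNReal.ofReal_mul (by positivity), ← hD]
    refine ENNReal.ofReal_le_ofReal ?_
    rw [mul_pow, ha2]
    have h1 : L⁻¹⁻¹ ^ 3 * (A⁻¹ * L⁻¹ ^ 3 * L⁻¹ ^ 2 * D) = D / A / L ^ 2 := by field_simp
    rw [h1, div_le_iff₀ (by positivity), div_le_iff₀ hA0]
    rw [div_le_iff₀ (by positivity)] at hLκ
    have : L ≤ L ^ 2 := by nlinarith
    have h3 : 0 < A * κ := by positivity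
    nlinarith

/-- The potential of a density `w²` is controlled by the kinetic energy of `w`. -/
theorem lintegral_inv_enorm_sub_le {w : E3 → ℝ} (hw : ContDiff ℝ ∞ w) (hw0 : ∀ x, 0 ≤ w x)
    (hw1 : ∫⁻ x, ENNReal.ofReal (w x ^ 2) = 1) (x : E3) :
    (∫⁻ y, ‖x - y‖ₑ⁻¹ ∂(volume.withDensity fun x => ENNReal.ofReal (w x ^ 2))) ^ 2
      ≤ 4 * ∫⁻ y, ‖fderiv ℝ w y‖ₑ ^ 2 := by
  have hwc := hw.continuous
  have e1 : ∀ y, ENNReal.ofReal (w y ^ 2) = ‖w y‖ₑ ^ 2 := fun y => by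
    rw [ENNReal.ofReal_pow (hw0 y), Real.enorm_of_nonneg (hw0 y)]
  simp only [e1] at hw1 ⊢
  rw [lintegral_withDensity_eq_lintegral_mul₀ (by fun_prop) (by fun_prop)]
  have h := sq_lintegral_mul_le (μ := (volume : Measure E3)) (f := fun y => ‖w y‖ₑ)
    (g := fun y => ‖w y‖ₑ * ‖x - y‖ₑ⁻¹) (by fun_prop) (by fun_prop)
  rw [hw1, one_mul] at h
  -- Hardy is centred at x itself, so the bound is uniform in x.
  have hH := hardy_of_contDiff (hw.of_le (by simp)) (by rw [hw1]; simp) x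
  refine le_trans (le_of_eq ?_) (h.trans (le_trans (le_of_eq ?_) hH))
  · congr 1
    exact lintegral_congr fun y => by rw [Pi.mul_apply]; ring
  · exact lintegral_congr fun y => by rw [mul_pow, ← enorm_neg (x - y), neg_sub]

/-! ### Correlation cost of relocation -/

/-- For t uniform on (0, 1] the event t ≤ s has probability s: this is the coin deciding whether a
particle is kept. -/
theorem setLIntegral_Ioc_ite_le {s : ℝ} (h0 : 0 ≤ s) (h1 : s ≤ 1) (a b : ℝ≥0∞) :
    ∫⁻ t in Set.Ioc (0 : ℝ) 1, (if t ≤ s then a else b)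
      = ENNReal.ofReal s * a + ENNReal.ofReal (1 - s) * b := by
  rw [← Set.Ioc_union_Ioc_eq_Ioc h0 h1, lintegral_union measurableSet_Ioc
    (Set.Ioc_disjoint_Ioc_of_le le_rfl)]
  have e1 : ∫⁻ t in Set.Ioc (0 : ℝ) s, (if t ≤ s then a else b) = ∫⁻ t in Set.Ioc (0 : ℝ) s, a :=
    setLIntegral_congr_fun measurableSet_Ioc fun t ht => if_pos ht.2
  have e2 : ∫⁻ t in Set.Ioc s (1 : ℝ), (if t ≤ s then a else b) = ∫⁻ t in Set.Ioc s (1 : ℝ), b :=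
    setLIntegral_congr_fun measurableSet_Ioc fun t ht => if_neg (not_le.2 ht.1)
  rw [e1, e2]
  simp [mul_comm]

theorem lintegral_pi_eval {N : ℕ} (ν : Measure E3) [IsProbabilityMeasure ν] (j : Fin N)
    {f : E3 → ℝ≥0∞} (hf : Measurable f) :
    ∫⁻ y, f (y j) ∂(Measure.pi fun _ : Fin N => ν) = ∫⁻ y, f y ∂ν :=
  (measurePreserving_eval (fun _ : Fin N => ν) j).lintegral_comp hf

theorem lintegral_pi_pair {N : ℕ} (ν : Measure E3) [IsProbabilityMeasure ν] {i j : Fin N}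
    (hij : i ≠ j) {f : E3 × E3 → ℝ≥0∞} (hf : Measurable f) :
    ∫⁻ y, f (y i, y j) ∂(Measure.pi fun _ : Fin N => ν) = ∫⁻ x, ∫⁻ y, f (x, y) ∂ν ∂ν := by
  have hind : ProbabilityTheory.iIndepFun (fun (i : Fin N) (y : Fin N → E3) => y i)
      (Measure.pi fun _ : Fin N => ν) :=
    ProbabilityTheory.iIndepFun_pi (X := fun _ => id) fun _ => aemeasurable_id
  have h := (ProbabilityTheory.indepFun_iff_map_prod_eq_prod_map_map
    (measurable_pi_apply i).aemeasurable (measurable_pi_apply j).aemeasurable).1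
    (hind.indepFun hij)
  rw [(measurePreserving_eval (fun _ : Fin N => ν) i).map_eq,
    (measurePreserving_eval (fun _ : Fin N => ν) j).map_eq] at h
  rw [← lintegral_prod _ hf.aemeasurable, ← h, lintegral_map hf (by fun_prop)]

theorem measurable_coulombCost {N : ℕ} : Measurable (coulombCost (N := N)) := by
  unfold coulombCost
  fun_prop

theorem correlation_le {N : ℕ} {ρ : Measure E3} (P : Measure (Fin N → E3)) [IsProbabilityMeasure P]
    (hP : ∀ i : Fin N, P.map (fun x => x i) = ρ) : correlation N ρ ≤ ∫⁻ x, coulombCost x ∂P := by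
  rw [correlation]
  exact iInf_le_of_le P <| iInf_le_of_le inferInstance <| iInf_le_of_le hP le_rfl

/-- Keep the `i`-th particle `x i` if `t ≤ ζ(x i)²`, and replace it by `y i` otherwise. -/
noncomputable def swap {N : ℕ} (ζ : E3 → ℝ) (q : (Fin N → E3) × ℝ × (Fin N → E3)) (i : Fin N) :
    E3 :=
  if q.2.1 ≤ ζ (q.1 i) ^ 2 then q.1 i else q.2.2 i

theorem measurable_swap {N : ℕ} {ζ : E3 → ℝ} (hζ : Measurable ζ) (i : Fin N) :
    Measurable fun q => swap ζ q i := by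
  unfold swap
  refine Measurable.ite (measurableSet_le (by fun_prop) (by fun_prop)) (by fun_prop) (by fun_prop)

/-- From a coupling P of ρ, draw independently a uniform t and N fresh particles of law ν, and apply
`swap`. All particles may share the same t, because only the marginals are prescribed. A pair of
kept particles costs what it did before; any other pair contains a fresh particle and costs at most
K on average. -/
theorem correlation_relocate_le (N : ℕ) (ρ ν : Measure E3) [IsProbabilityMeasure ν] {ζ : E3 → ℝ}
    (hζ : Measurable ζ) (h0 : ∀ x, 0 ≤ ζ x) (h1 : ∀ x, ζ x ≤ 1) {K : ℝ≥0∞}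
    (hK : ∀ x, ∫⁻ y, ‖x - y‖ₑ⁻¹ ∂ν ≤ K) :
    correlation N (relocate ρ ζ ν) ≤ correlation N ρ + (N * N : ℕ) * (3 * K) := by
  conv_rhs => rw [correlation]
  simp only [ENNReal.iInf_add]
  refine le_iInf fun P => le_iInf fun hPp => le_iInf fun hP => ?_
  have hlam : IsProbabilityMeasure ((volume : Measure ℝ).restrict (Set.Ioc 0 1)) :=
    ⟨by simp⟩
  set lam := (volume : Measure ℝ).restrict (Set.Ioc 0 1) with hlamdef
  set M := Measure.pi fun _ : Fin N => ν with hM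
  set Q := P.prod (lam.prod M) with hQ
  have hsw : Measurable (swap (N := N) ζ) := measurable_pi_iff.2 fun i => measurable_swap hζ i
  have hQ' : IsProbabilityMeasure (Q.map (swap ζ)) := Measure.isProbabilityMeasure_map hsw.aemeasurable
  refine (correlation_le (Q.map (swap ζ)) fun i => ?_).trans ?_
  · rw [Measure.map_map (by fun_prop) hsw]
    ext A hA
    have hind : Measurable (A.indicator (1 : E3 → ℝ≥0∞)) := measurable_one.indicator hA
    have hm1 : Measurable fun q : (Fin N → E3) × ℝ × (Fin N → E3) =>
        A.indicator (1 : E3 → ℝ≥0∞) (swap ζ q i) := hind.comp (measurable_swap hζ i)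
    have hx : ∀ x : Fin N → E3, ∫⁻ r, A.indicator (1 : E3 → ℝ≥0∞) (swap ζ (x, r) i) ∂(lam.prod M)
        = ENNReal.ofReal (ζ (x i) ^ 2) * A.indicator 1 (x i)
          + ENNReal.ofReal (1 - ζ (x i) ^ 2) * ν A := by
      intro x
      have hm2 : Measurable fun r => A.indicator (1 : E3 → ℝ≥0∞) (swap ζ (x, r) i) :=
        hm1.comp measurable_prodMk_left
      rw [lintegral_prod _ hm2.aemeasurable,
        ← setLIntegral_Ioc_ite_le (sq_nonneg _) (pow_le_one₀ (h0 (x i)) (h1 (x i)))]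
      refine lintegral_congr fun t => ?_
      by_cases ht : t ≤ ζ (x i) ^ 2
      · simp [swap, ht]
      · simp only [swap, ht, if_false]
        rw [lintegral_pi_eval ν i hind, lintegral_indicator_one hA]
    calc _ = ∫⁻ q, A.indicator (1 : E3 → ℝ≥0∞) (swap ζ q i) ∂Q := by
          rw [← lintegral_indicator_one hA, lintegral_map hind (by fun_prop)]
          rfl
      _ = ∫⁻ x, (ENNReal.ofReal (ζ (x i) ^ 2) * A.indicator 1 (x i)
          + ENNReal.ofReal (1 - ζ (x i) ^ 2) * ν A) ∂P := by
          rw [hQ, lintegral_prod _ hm1.aemeasurable]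
          exact lintegral_congr hx
      _ = ∫⁻ x, (ENNReal.ofReal (ζ x ^ 2) * A.indicator 1 x
          + ENNReal.ofReal (1 - ζ x ^ 2) * ν A) ∂ρ := by
          rw [← hP i, lintegral_map (by fun_prop) (by fun_prop)]
      _ = _ := by
          rw [lintegral_add_left (by fun_prop), lintegral_mul_const _ (by fun_prop), relocate,
            Measure.add_apply, withDensity_apply _ hA, ← lintegral_indicator hA,
            Measure.smul_apply, smul_eq_mul]
          congr 1
          refine lintegral_congr fun x => ?_
          by_cases hxA : x ∈ A <;> simp [hxA]
  · rw [lintegral_map measurable_coulombCost hsw]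
    -- The four keep-or-replace cases of a pair are bounded by the sum of all four costs, so the
    -- dependence on t disappears. The last three give 3K, and N² crudely bounds the number of
    -- pairs.
    have hpt : ∀ q : (Fin N → E3) × ℝ × (Fin N → E3), coulombCost (swap ζ q)
        ≤ coulombCost q.1 + ∑ p : Fin N × Fin N with p.1 < p.2, (‖q.1 p.1 - q.2.2 p.2‖ₑ⁻¹
          + ‖q.2.2 p.1 - q.1 p.2‖ₑ⁻¹ + ‖q.2.2 p.1 - q.2.2 p.2‖ₑ⁻¹) := by
      intro q
      rw [coulombCost, coulombCost, ← Finset.sum_add_distrib]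
      refine Finset.sum_le_sum fun p _ => ?_
      simp only [swap]
      split_ifs
      · exact le_self_add
      · exact le_add_left (le_add_right le_self_add)
      · exact le_add_left (le_add_right le_add_self)
      · exact le_add_left le_add_self
    refine (lintegral_mono hpt).trans ?_
    have hcm : Measurable fun q : (Fin N → E3) × ℝ × (Fin N → E3) => coulombCost q.1 :=
      measurable_coulombCost.comp measurable_fst
    rw [lintegral_add_left hcm]
    have hfst : ∫⁻ q, coulombCost q.1 ∂Q = ∫⁻ x, coulombCost x ∂P := by
      rw [hQ, lintegral_prod _ hcm.aemeasurable]
      simp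
    rw [hfst, lintegral_finsetSum _ (fun p _ => by fun_prop)]
    gcongr
    have hterm : ∀ p ∈ Finset.univ.filter (fun p : Fin N × Fin N => p.1 < p.2),
        ∫⁻ q, (‖q.1 p.1 - q.2.2 p.2‖ₑ⁻¹ + ‖q.2.2 p.1 - q.1 p.2‖ₑ⁻¹
          + ‖q.2.2 p.1 - q.2.2 p.2‖ₑ⁻¹) ∂Q ≤ 3 * K := by
      intro p hp
      have hp' : p.1 ≠ p.2 := (Finset.mem_filter.1 hp).2.ne
      rw [hQ, lintegral_prod _ (by fun_prop)]
      have hx : ∀ x : Fin N → E3, ∫⁻ r : ℝ × (Fin N → E3), (‖x p.1 - r.2 p.2‖ₑ⁻¹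
          + ‖r.2 p.1 - x p.2‖ₑ⁻¹ + ‖r.2 p.1 - r.2 p.2‖ₑ⁻¹) ∂(lam.prod M) ≤ 3 * K := by
        intro x
        rw [lintegral_prod _ (by fun_prop)]
        simp only [lintegral_const, measure_univ, mul_one]
        rw [lintegral_add_left (by fun_prop), lintegral_add_left (by fun_prop),
          lintegral_pi_eval ν p.2 (f := fun y => ‖x p.1 - y‖ₑ⁻¹) (by fun_prop),
          lintegral_pi_eval ν p.1 (f := fun y => ‖y - x p.2‖ₑ⁻¹) (by fun_prop),
          lintegral_pi_pair ν hp' (f := fun z => ‖z.1 - z.2‖ₑ⁻¹) (by fun_prop)]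
        have k1 := hK (x p.1)
        have k2 : ∫⁻ y, ‖y - x p.2‖ₑ⁻¹ ∂ν ≤ K := by
          simpa only [← enorm_neg (_ - x p.2), neg_sub] using hK (x p.2)
        have k3 : ∫⁻ y, ∫⁻ z, ‖y - z‖ₑ⁻¹ ∂ν ∂ν ≤ K :=
          (lintegral_mono hK).trans (by simp)
        calc _ ≤ K + K + K := add_le_add (add_le_add k1 k2) k3
          _ = 3 * K := by ring
      exact (lintegral_mono hx).trans (by simp)
    refine (Finset.sum_le_card_nsmul _ _ _ hterm).trans ?_
    rw [nsmul_eq_mul]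
    gcongr
    refine (Finset.card_filter_le _ _).trans ?_
    simp

/-! ### Behaviour under dilations -/

theorem memLp_two_of_lintegral {X F : Type*} [MeasurableSpace X] [NormedAddCommGroup F]
    {μ : Measure X} {h : X → F} (hm : AEStronglyMeasurable h μ) (hh : ∫⁻ x, ‖h x‖ₑ ^ 2 ∂μ < ⊤) :
    MemLp h 2 μ :=
  (memLp_two_iff_integrable_sq_norm hm).2 (integrable_norm_sq_of_lintegral hm hh)

theorem memLp_two_comp_smul {F : Type*} [NormedAddCommGroup F] {h : E3 → F} (hh : MemLp h 2)
    {r : ℝ} (hr : 0 < r) : MemLp (fun x => h (r • x)) 2 := by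
  have hq : Measure.QuasiMeasurePreserving (fun x : E3 => r • x) := by
    refine ⟨measurable_const_smul r, ?_⟩
    rw [Measure.map_addHaar_smul _ hr.ne']
    exact Measure.smul_absolutelyContinuous
  refine memLp_two_of_lintegral (hh.1.comp_quasiMeasurePreserving hq) ?_
  rw [lintegral_comp_smul (fun x => ‖h x‖ₑ ^ 2) hr]
  exact ENNReal.mul_lt_top ENNReal.ofReal_lt_top (lintegral_enorm_sq_lt_top hh)

theorem IsWeakGradient.comp_smul {u : E3 → ℝ} {v : E3 → E3} (huv : IsWeakGradient u v) (a : ℝ)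
    {r : ℝ} (hr : 0 < r) :
    IsWeakGradient (fun x => a * u (r • x)) (fun x => (a * r) • v (r • x)) := by
  intro φ hφ hc e
  have hrr : ∀ x : E3, r⁻¹ • r • x = x := fun x => inv_smul_smul₀ hr.ne' x
  have h := huv (fun x => φ (r⁻¹ • x)) (hφ.comp (contDiff_const_smul _))
    (hc.comp_homeomorph (Homeomorph.smulOfNeZero r⁻¹ (inv_ne_zero hr.ne'))) e
  simp only [fderiv_comp_smul, smul_apply, smul_eq_mul] at h
  have e1 : ∫ x, a * u (r • x) * fderiv ℝ φ x e
      = |(r ^ Module.finrank ℝ E3)⁻¹| • ∫ x, a * u x * fderiv ℝ φ (r⁻¹ • x) e := by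
    rw [← Measure.integral_comp_smul]
    simp only [hrr]
  have e2 : ∫ x, inner ℝ ((a * r) • v (r • x)) e * φ x
      = |(r ^ Module.finrank ℝ E3)⁻¹| • ∫ x, inner ℝ ((a * r) • v x) e * φ (r⁻¹ • x) := by
    rw [← Measure.integral_comp_smul volume
      (fun x => inner ℝ ((a * r) • v x) e * φ (r⁻¹ • x))]
    simp only [hrr]
  rw [e1, e2, ← smul_neg]
  congr 1
  have e3 : ∫ x, a * u x * fderiv ℝ φ (r⁻¹ • x) e
      = a * r * ∫ x, u x * (r⁻¹ * fderiv ℝ φ (r⁻¹ • x) e) := by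
    rw [← integral_const_mul]
    refine integral_congr_ae (ae_of_all _ fun x => ?_)
    field_simp
  have e4 : ∫ x, inner ℝ ((a * r) • v x) e * φ (r⁻¹ • x)
      = a * r * ∫ x, inner ℝ (v x) e * φ (r⁻¹ • x) := by
    rw [← integral_const_mul]
    refine integral_congr_ae (ae_of_all _ fun x => ?_)
    simp only [inner_smul_left, conj_trivial]
    ring
  rw [e3, e4, h, mul_neg]

/-- With r = λ⁻¹, the dilated density has root r^{3/2} u(rx) and gradient r^{5/2} v(rx). An
inequality is enough: it is applied with λ = ε⁻¹ for the lower bound and with λ = ε for the upper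
one. -/
theorem kinetic_map_smul_le (ρ : Measure E3) {lam : ℝ} (hl : 0 < lam) :
    kinetic (ρ.map fun x => lam • x) ≤ ENNReal.ofReal (lam⁻¹ ^ 2) * kinetic ρ := by
  have hl' : ENNReal.ofReal (lam⁻¹ ^ 2) ≠ 0 := by
    simp only [ne_eq, ENNReal.ofReal_eq_zero, not_le]; positivity
  conv_rhs => rw [kinetic]
  simp only [ENNReal.mul_iInf_of_ne hl' ENNReal.ofReal_ne_top]
  refine le_iInf fun u => le_iInf fun v => le_iInf fun hu0 => le_iInf fun hu => le_iInf fun hv =>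
    le_iInf fun huv => le_iInf fun hρ => ?_
  set r := lam⁻¹ with hr
  have hr0 : 0 < r := inv_pos.2 hl
  set a := √(r ^ 3) with ha
  have ha0 : 0 ≤ a := Real.sqrt_nonneg _
  have ha2 : a ^ 2 = r ^ 3 := Real.sq_sqrt (by positivity)
  have hcancel : ENNReal.ofReal (r⁻¹ ^ 3) * ENNReal.ofReal (a ^ 2) = 1 := by
    rw [← ENNReal.ofReal_mul (by positivity), ha2, ← mul_pow, inv_mul_cancel₀ hr0.ne']
    simp
  have hmeas : (ρ.map fun x => lam • x)
      = volume.withDensity fun x => ENNReal.ofReal ((a * u (r • x)) ^ 2) := by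
    ext A hA
    have hpre : MeasurableSet ((fun x : E3 => lam • x) ⁻¹' A) := measurable_const_smul lam hA
    rw [Measure.map_apply (measurable_const_smul lam) hA, hρ, withDensity_apply _ hpre,
      withDensity_apply _ hA, ← lintegral_indicator hpre, ← lintegral_indicator hA]
    have e1 : ∀ x, A.indicator (fun x => ENNReal.ofReal ((a * u (r • x)) ^ 2)) x
        = (fun y => ENNReal.ofReal (a ^ 2) * ((fun x : E3 => lam • x) ⁻¹' A).indicator
          (fun y => ENNReal.ofReal (u y ^ 2)) y) (r • x) := by
      intro x
      have hx : lam • r • x = x := smul_inv_smul₀ hl.ne' x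
      by_cases hxA : x ∈ A
      · simp [hxA, hx, mul_pow, ENNReal.ofReal_mul (sq_nonneg a)]
      · simp [hxA, hx]
    simp only [e1]
    rw [lintegral_comp_smul (fun y => ENNReal.ofReal (a ^ 2) *
      ((fun x : E3 => lam • x) ⁻¹' A).indicator (fun y => ENNReal.ofReal (u y ^ 2)) y) hr0,
      lintegral_const_mul' _ _ ENNReal.ofReal_ne_top, ← mul_assoc, hcancel, one_mul]
  refine (kinetic_le (fun x => mul_nonneg ha0 (hu0 _)) ((memLp_two_comp_smul hu hr0).const_mul a)
    ((memLp_two_comp_smul hv hr0).const_smul (a * r)) (huv.comp_smul a hr0) hmeas).trans ?_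
  refine le_of_eq ?_
  simp only [Pi.smul_apply, enorm_smul, mul_pow]
  rw [lintegral_const_mul' _ _ (ENNReal.pow_ne_top enorm_ne_top),
    lintegral_comp_smul (fun x => ‖v x‖ₑ ^ 2) hr0, ← mul_assoc]
  congr 1
  rw [Real.enorm_of_nonneg (by positivity), ← ENNReal.ofReal_pow (by positivity), mul_pow,
    ENNReal.ofReal_mul (by positivity), mul_comm, ← mul_assoc, hcancel, one_mul]

theorem enorm_smul_inv {lam : ℝ} (hl : 0 < lam) (x : E3) :
    ‖lam • x‖ₑ⁻¹ = ENNReal.ofReal lam⁻¹ * ‖x‖ₑ⁻¹ := by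
  rw [enorm_smul, Real.enorm_of_nonneg hl.le, ENNReal.mul_inv
    (Or.inl (by simpa using hl)) (Or.inl ENNReal.ofReal_ne_top), ENNReal.ofReal_inv_of_pos hl]

theorem correlation_map_smul_le (N : ℕ) (ρ : Measure E3) {lam : ℝ} (hl : 0 < lam) :
    correlation N (ρ.map fun x => lam • x) ≤ ENNReal.ofReal lam⁻¹ * correlation N ρ := by
  have hl' : ENNReal.ofReal lam⁻¹ ≠ 0 := by
    simp only [ne_eq, ENNReal.ofReal_eq_zero, not_le]; positivity
  conv_rhs => rw [correlation]
  simp only [ENNReal.mul_iInf_of_ne hl' ENNReal.ofReal_ne_top]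
  refine le_iInf fun P => le_iInf fun hPp => le_iInf fun hP => ?_
  have hm : Measurable fun (x : Fin N → E3) (i : Fin N) => lam • x i := by fun_prop
  have hQ' := Measure.isProbabilityMeasure_map (μ := P) hm.aemeasurable
  refine (correlation_le (P.map fun (x : Fin N → E3) (i : Fin N) => lam • x i) fun i => ?_).trans ?_
  · rw [Measure.map_map (by fun_prop) hm, ← hP i, Measure.map_map (by fun_prop) (by fun_prop)]
    rfl
  · rw [lintegral_map measurable_coulombCost hm,
      ← lintegral_const_mul' _ _ ENNReal.ofReal_ne_top]
    refine lintegral_mono fun x => le_of_eq ?_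
    simp only [coulombCost, Finset.mul_sum, ← smul_sub, enorm_smul_inv hl]

theorem potential_map_smul (ρ : Measure E3) {lam : ℝ} (hl : 0 < lam) :
    potential (ρ.map fun x => lam • x) = ENNReal.ofReal lam⁻¹ * potential ρ := by
  rw [potential, potential, lintegral_map (by fun_prop) (by fun_prop),
    ← lintegral_const_mul' _ _ ENNReal.ofReal_ne_top]
  simp only [enorm_smul_inv hl]

theorem energy_map_smul_le (N : ℕ) {t c z : ℝ} (ht : 0 ≤ t) (hc : 0 ≤ c) (hz : 0 ≤ z)
    (ρ : Measure E3) {lam : ℝ} (hl : 0 < lam) :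
    energy N t c z (ρ.map fun x => lam • x)
      ≤ energy N (t * lam⁻¹ ^ 2) (c * lam⁻¹) (z * lam⁻¹) ρ := by
  have hk := kinetic_map_smul_le ρ hl
  by_cases h : kinetic ρ = ⊤
  · simp [energy, h]
  have h' : kinetic (ρ.map fun x => lam • x) ≠ ⊤ :=
    (hk.trans_lt (ENNReal.mul_lt_top ENNReal.ofReal_lt_top (lt_top_iff_ne_top.2 h))).ne
  simp only [energy, h, h', if_false]
  refine EReal.sub_le_sub ?_ ?_
  · rw [EReal.coe_ennreal_le_coe_ennreal_iff, ENNReal.ofReal_mul ht, ENNReal.ofReal_mul hc,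
      mul_assoc, mul_assoc]
    gcongr
    exact correlation_map_smul_le N ρ hl
  · rw [potential_map_smul ρ hl, ENNReal.ofReal_mul hz, mul_assoc]

/-! ### Finiteness and coercivity of the energy -/

theorem potential_ne_top {ρ : Measure E3} [IsProbabilityMeasure ρ] (h : kinetic ρ ≠ ⊤) :
    potential ρ ≠ ⊤ := by
  have h1 := sq_setLIntegral_inv_norm_le ρ Set.univ
  rw [Measure.restrict_univ, measure_univ, one_mul] at h1
  intro h2
  rw [potential] at h2
  rw [h2] at h1
  have h3 : 4 * kinetic ρ < ⊤ := ENNReal.mul_lt_top (by norm_num) (lt_top_iff_ne_top.2 h)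
  exact h3.not_ge (by simpa using h1)

theorem potential_toReal_sq_le {ρ : Measure E3} [IsProbabilityMeasure ρ] (h : kinetic ρ ≠ ⊤) :
    (potential ρ).toReal ^ 2 ≤ 4 * (kinetic ρ).toReal := by
  have h1 := sq_setLIntegral_inv_norm_le ρ Set.univ
  rw [Measure.restrict_univ, measure_univ, one_mul] at h1
  have h2 := ENNReal.toReal_mono (ENNReal.mul_ne_top (by norm_num) h) h1
  simpa [potential] using h2

theorem energy_eq_coe (N : ℕ) {t c z : ℝ} (ht : 0 ≤ t) (hc : 0 ≤ c) (hz : 0 ≤ z)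
    {ρ : Measure E3} [IsProbabilityMeasure ρ] (hT : kinetic ρ ≠ ⊤) (hC : correlation N ρ ≠ ⊤) :
    energy N t c z ρ = ((t * (kinetic ρ).toReal + c * (correlation N ρ).toReal
      - z * (potential ρ).toReal : ℝ) : EReal) := by
  have hU := potential_ne_top hT
  have e1 : ENNReal.ofReal t * kinetic ρ + ENNReal.ofReal c * correlation N ρ
      = ENNReal.ofReal (t * (kinetic ρ).toReal + c * (correlation N ρ).toReal) := by
    rw [ENNReal.ofReal_add (by positivity) (by positivity), ENNReal.ofReal_mul ht,
      ENNReal.ofReal_mul hc, ENNReal.ofReal_toReal hT, ENNReal.ofReal_toReal hC]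
  have e2 : ENNReal.ofReal z * potential ρ = ENNReal.ofReal (z * (potential ρ).toReal) := by
    rw [ENNReal.ofReal_mul hz, ENNReal.ofReal_toReal hU]
  rw [energy, if_neg hT, e1, e2, EReal.coe_ennreal_ofReal, EReal.coe_ennreal_ofReal,
    max_eq_left (by positivity), max_eq_left (by positivity), EReal.coe_sub]

/-- Finite T makes the subtracted potential finite, so it cannot compensate an infinite correlation
term. -/
theorem correlation_ne_top_of_energy_ne_top {N : ℕ} {t c z : ℝ} (hc : 0 < c) {ρ : Measure E3}
    [IsProbabilityMeasure ρ] (h : energy N t c z ρ ≠ ⊤) :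
    kinetic ρ ≠ ⊤ ∧ correlation N ρ ≠ ⊤ := by
  have hT : kinetic ρ ≠ ⊤ := fun hT => h (by simp [energy, hT])
  refine ⟨hT, fun hC => h ?_⟩
  have hc' : ENNReal.ofReal c ≠ 0 := by simpa using hc
  have hU : ENNReal.ofReal z * potential ρ ≠ ⊤ :=
    ENNReal.mul_ne_top ENNReal.ofReal_ne_top (potential_ne_top hT)
  rw [energy, if_neg hT, hC, ENNReal.mul_top hc', add_top, EReal.coe_ennreal_top]
  obtain ⟨x, hx⟩ : ∃ x : ℝ, ((ENNReal.ofReal z * potential ρ : ℝ≥0∞) : EReal) = x :=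
    ⟨_, (EReal.coe_ennreal_toReal hU).symm⟩
  rw [hx, EReal.top_sub_coe]

/-- The energy controls the kinetic energy. -/
theorem kinetic_toReal_le {N : ℕ} {b Z : ℝ} (hb : 0 < b) (hZ : 0 ≤ Z) {ρ : Measure E3}
    [IsProbabilityMeasure ρ] {c : ℝ} (h : energy N 1 b Z ρ < c) :
    (kinetic ρ).toReal ≤ 2 * c + 4 * Z ^ 2 := by
  obtain ⟨hT, hC⟩ := correlation_ne_top_of_energy_ne_top hb (h.trans (EReal.coe_lt_top c)).ne
  rw [energy_eq_coe N zero_le_one hb.le hZ hT hC, EReal.coe_lt_coe_iff] at h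
  have h1 := potential_toReal_sq_le hT
  have h2 : 0 ≤ b * (correlation N ρ).toReal := by positivity
  -- The square gives 8ZU ≤ U² + 16Z², and U² ≤ 4T then yields ZU ≤ T/2 + 2Z², so half of T
  -- survives.
  nlinarith [sq_nonneg ((potential ρ).toReal - 4 * Z)]

/-! ### Energy cost of relocation -/

/-- Relocating mass far away at a controlled cost. -/
theorem exists_relocate_energy_le (N : ℕ) {b Z : ℝ} (hb : 0 < b) (hZ : 0 ≤ Z) {ρ : Measure E3}
    [IsProbabilityMeasure ρ] (hE : energy N 1 b Z ρ ≠ ⊤) {ζ : E3 → ℝ}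
    (hζ : ContDiff ℝ ∞ ζ) (hζc : HasCompactSupport ζ) (h0 : ∀ x, 0 ≤ ζ x) (h1 : ∀ x, ζ x ≤ 1)
    {r : ℝ} (hr : ∀ x, r ≤ ‖x‖ → ζ x = 0) {θ κ G V : ℝ} (hθ : 0 < θ) (hκ : 0 < κ)
    (hG0 : 0 ≤ G) (hV0 : 0 ≤ V)
    (hG : ∫⁻ x, ‖fderiv ℝ ζ x‖ₑ ^ 2 ∂ρ ≤ ENNReal.ofReal G)
    (hV : ∫⁻ x, ENNReal.ofReal (1 - ζ x ^ 2) * ‖x‖ₑ⁻¹ ∂ρ ≤ ENNReal.ofReal V) :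
    ∃ ν : Measure E3, IsProbabilityMeasure ν ∧ ν (Metric.ball 0 r) = 0 ∧
      energy N 1 b Z (relocate ρ ζ ν) ≤ energy N 1 b Z ρ
        + ((θ * (kinetic ρ).toReal + 2 * (1 + 1 / θ) * G + Z * V + κ : ℝ) : EReal) := by
  obtain ⟨hT, hC⟩ := correlation_ne_top_of_energy_ne_top hb hE
  -- A bump of kinetic energy at most k² has Coulomb potential at most 2k everywhere; k is taken so
  -- small that its kinetic and correlation costs are each at most κ/2.
  obtain ⟨k, hk0, hk1, hk2⟩ : ∃ k : ℝ, 0 < k ∧ 2 * (1 + 1 / θ) * k ^ 2 ≤ κ / 2 ∧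
      b * ((N * N : ℕ) * (3 * (2 * k))) ≤ κ / 2 := by
    have l1 : Tendsto (fun k : ℝ => 2 * (1 + 1 / θ) * k ^ 2) (𝓝[>] 0) (𝓝 0) := by
      have : ContinuousAt (fun k : ℝ => 2 * (1 + 1 / θ) * k ^ 2) 0 := by fun_prop
      simpa using this.tendsto.mono_left nhdsWithin_le_nhds
    have l2 : Tendsto (fun k : ℝ => b * ((N * N : ℕ) * (3 * (2 * k)))) (𝓝[>] 0) (𝓝 0) := by
      have : ContinuousAt (fun k : ℝ => b * ((N * N : ℕ) * (3 * (2 * k)))) 0 := by fun_prop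
      simpa using this.tendsto.mono_left nhdsWithin_le_nhds
    obtain ⟨k, ⟨hk1, hk2⟩, hk0⟩ := (((l1.eventually_le_const (half_pos hκ)).and
      (l2.eventually_le_const (half_pos hκ))).and self_mem_nhdsWithin).exists
    exact ⟨k, hk0, hk1, hk2⟩
  obtain ⟨w, hw, hwc, hw0, hw1, hwr, hwd⟩ := exists_far_bump r (κ := k ^ 2) (by positivity)
  set ν : Measure E3 := volume.withDensity fun x => ENNReal.ofReal (w x ^ 2) with hν
  have hνp : IsProbabilityMeasure ν :=
    ⟨by rw [hν, withDensity_apply _ MeasurableSet.univ, Measure.restrict_univ, hw1]⟩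
  have hνr : ν (Metric.ball 0 r) = 0 := by
    rw [hν, withDensity_apply _ measurableSet_ball, setLIntegral_congr_fun measurableSet_ball
      (g := fun _ => 0) (fun x hx => by simp [hwr x hx])]
    simp
  have hζw : ∀ x, ζ x * w x = 0 := fun x => by
    by_cases hx : r ≤ ‖x‖
    · simp [hr x hx]
    · simp [hwr x (by simpa using hx)]
  have hKs : ∀ x, ∫⁻ y, ‖x - y‖ₑ⁻¹ ∂ν ≤ ENNReal.ofReal (2 * k) := by
    intro x
    have h2 : (∫⁻ y, ‖x - y‖ₑ⁻¹ ∂ν) ^ 2 ≤ ENNReal.ofReal (2 * k) ^ 2 := by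
      refine (lintegral_inv_enorm_sub_le hw hw0 hw1 x).trans ((mul_le_mul_right hwd 4).trans ?_)
      rw [← ENNReal.ofReal_pow (by positivity), mul_pow, ENNReal.ofReal_mul (by norm_num)]
      norm_num
    exact (ENNReal.pow_le_pow_left_iff two_ne_zero).1 h2
  have hpr := isProbabilityMeasure_relocate ρ ν hζ.continuous.measurable h0 h1
  have hkin := kinetic_relocate_le ρ hζ hζc h0 h1 hw hwc hw0 hζw hθ
  have hcor := correlation_relocate_le N ρ ν hζ.continuous.measurable h0 h1 hKs
  rw [← hν] at hkin
  set τ := kinetic ρ with hτ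
  have hkin' : kinetic (relocate ρ ζ ν) ≤ ENNReal.ofReal ((1 + θ) * τ.toReal
      + 2 * (1 + 1 / θ) * (G + k ^ 2)) := by
    refine hkin.trans ?_
    rw [ENNReal.ofReal_add (p := (1 + θ) * τ.toReal) (by positivity) (by positivity),
      ENNReal.ofReal_mul (p := 1 + θ) (by positivity),
      ENNReal.ofReal_mul (p := 2 * (1 + 1 / θ)) (by positivity), ENNReal.ofReal_toReal hT,
      ENNReal.ofReal_add hG0 (by positivity)]
    gcongr
  have hcor' : correlation N (relocate ρ ζ ν) ≤ ENNReal.ofReal ((correlation N ρ).toReal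
      + (N * N : ℕ) * (3 * (2 * k))) := by
    refine hcor.trans (le_of_eq ?_)
    rw [ENNReal.ofReal_add (by positivity) (by positivity), ENNReal.ofReal_toReal hC,
      ENNReal.ofReal_mul (p := ((N * N : ℕ) : ℝ)) (by positivity), ENNReal.ofReal_natCast,
      ENNReal.ofReal_mul (p := (3 : ℝ)) (by norm_num)]
    norm_num
  have hT' : kinetic (relocate ρ ζ ν) ≠ ⊤ := (hkin'.trans_lt ENNReal.ofReal_lt_top).ne
  have hC' : correlation N (relocate ρ ζ ν) ≠ ⊤ := (hcor'.trans_lt ENNReal.ofReal_lt_top).ne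
  have hU' := potential_ne_top hT'
  -- The attraction felt by ν is discarded; only that of the removed part of ρ is lost.
  have hpot : potential ρ ≤ potential (relocate ρ ζ ν) + ENNReal.ofReal V := by
    have hzc := hζ.continuous
    have hle : ∫⁻ x, ENNReal.ofReal (ζ x ^ 2) * ‖x‖ₑ⁻¹ ∂ρ ≤ potential (relocate ρ ζ ν) := by
      rw [potential, relocate, lintegral_add_measure,
        lintegral_withDensity_eq_lintegral_mul₀ (by fun_prop) (by fun_prop)]
      exact le_self_add
    refine le_trans (le_of_eq ?_) (add_le_add hle hV)
    rw [← lintegral_add_left (by fun_prop), potential]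
    refine lintegral_congr fun x => ?_
    rw [← add_mul, ← ENNReal.ofReal_add (sq_nonneg _) (sub_nonneg.2 (pow_le_one₀ (h0 x) (h1 x)))]
    simp
  have rT := ENNReal.toReal_le_of_le_ofReal (by positivity) hkin'
  have rC := ENNReal.toReal_le_of_le_ofReal (by positivity) hcor'
  have rU : (potential ρ).toReal ≤ (potential (relocate ρ ζ ν)).toReal + V := by
    have := ENNReal.toReal_mono (ENNReal.add_ne_top.2 ⟨hU', ENNReal.ofReal_ne_top⟩) hpot
    rwa [ENNReal.toReal_add hU' ENNReal.ofReal_ne_top, ENNReal.toReal_ofReal hV0] at this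
  refine ⟨ν, hνp, hνr, ?_⟩
  rw [energy_eq_coe N zero_le_one hb.le hZ hT hC, energy_eq_coe N zero_le_one hb.le hZ hT' hC',
    ← EReal.coe_add, EReal.coe_le_coe_iff]
  have q1 := mul_le_mul_of_nonneg_left rC hb.le
  have q2 := mul_le_mul_of_nonneg_left rU hZ
  linarith

/-! ### Cutoffs and damping profiles -/

/-- A smooth cutoff equal to `1` on the ball of radius `L` and vanishing outside the ball of
radius `2 L`. -/
noncomputable def cutoff (L : ℝ) (x : E3) : ℝ :=
  (⟨1, 2, one_pos, one_lt_two⟩ : ContDiffBump (0 : E3)) (L⁻¹ • x)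

theorem contDiff_cutoff (L : ℝ) : ContDiff ℝ ∞ (cutoff L) :=
  (ContDiffBump.contDiff _).comp (contDiff_const_smul _)

theorem cutoff_nonneg (L : ℝ) (x : E3) : 0 ≤ cutoff L x := ContDiffBump.nonneg _

theorem cutoff_le_one (L : ℝ) (x : E3) : cutoff L x ≤ 1 := ContDiffBump.le_one _

theorem cutoff_eq_one {L : ℝ} (hL : 0 < L) {x : E3} (hx : ‖x‖ ≤ L) : cutoff L x = 1 := by
  refine ContDiffBump.one_of_mem_closedBall _ ?_
  rw [mem_closedBall_zero_iff, norm_smul, Real.norm_of_nonneg (inv_pos.2 hL).le,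
    inv_mul_le_iff₀ hL, mul_one]
  exact hx

theorem cutoff_eq_zero {L : ℝ} (hL : 0 < L) {x : E3} (hx : 2 * L ≤ ‖x‖) : cutoff L x = 0 := by
  refine ContDiffBump.zero_of_le_dist _ ?_
  rw [dist_zero_right, norm_smul, Real.norm_of_nonneg (inv_pos.2 hL).le, le_inv_mul_iff₀ hL,
    mul_comm]
  exact hx

theorem hasCompactSupport_cutoff {L : ℝ} (hL : 0 < L) : HasCompactSupport (cutoff L) :=
  HasCompactSupport.intro (isCompact_closedBall (0 : E3) (2 * L)) fun x hx =>
    cutoff_eq_zero hL (by simpa using (not_le.1 (mt mem_closedBall_zero_iff.2 hx)).le)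

theorem fderiv_cutoff_eq_zero {L : ℝ} (hL : 0 < L) {x : E3} (hx : x ∉ Metric.closedBall 0 (2 * L)) :
    fderiv ℝ (cutoff L) x = 0 := by
  have h : cutoff L =ᶠ[𝓝 x] fun _ => 0 := by
    filter_upwards [Metric.isClosed_closedBall.isOpen_compl.mem_nhds hx] with y hy
    exact cutoff_eq_zero hL (not_le.1 (mt mem_closedBall_zero_iff.2 hy)).le
  rw [h.fderiv_eq]
  simp

theorem exists_norm_fderiv_cutoff_le :
    ∃ D, ∀ L, 0 < L → ∀ x : E3, ‖fderiv ℝ (cutoff L) x‖ ≤ D / L := by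
  obtain ⟨D, hD⟩ := exists_norm_fderiv_le (ContDiffBump.contDiff _)
    (⟨1, 2, one_pos, one_lt_two⟩ : ContDiffBump (0 : E3)).hasCompactSupport
  refine ⟨D, fun L hL x => ?_⟩
  change ‖fderiv ℝ (fun x : E3 => (⟨1, 2, one_pos, one_lt_two⟩ : ContDiffBump (0 : E3))
    (L⁻¹ • x)) x‖ ≤ _
  rw [fderiv_comp_smul, norm_smul, Real.norm_of_nonneg (inv_pos.2 hL).le, div_eq_inv_mul]
  gcongr
  exact hD _

/-- A profile cutting off at the scale `L` and damping by the factor `1 - s` at the scale `R`. -/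
noncomputable def profile (L R s : ℝ) (x : E3) : ℝ := cutoff L x - s * cutoff R x

theorem profile_zero (L R : ℝ) : profile L R 0 = cutoff L := by
  ext x; simp [profile]

theorem contDiff_profile (L R s : ℝ) : ContDiff ℝ ∞ (profile L R s) :=
  (contDiff_cutoff L).sub (contDiff_const.mul (contDiff_cutoff R))

theorem hasCompactSupport_profile {L R : ℝ} (hL : 0 < L) (hR : 0 < R) (s : ℝ) :
    HasCompactSupport (profile L R s) :=
  (hasCompactSupport_cutoff hL).sub (hasCompactSupport_cutoff hR).mul_left

theorem profile_eq_zero {L R : ℝ} (hR : 0 < R) (hRL : 2 * R ≤ L) (s : ℝ) {x : E3}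
    (hx : 2 * L ≤ ‖x‖) : profile L R s x = 0 := by
  rw [profile, cutoff_eq_zero (by linarith) hx, cutoff_eq_zero hR (by linarith)]
  simp

theorem profile_eq_one_sub {L R : ℝ} (hR : 0 < R) (hRL : 2 * R ≤ L) (s : ℝ) {x : E3}
    (hx : ‖x‖ ≤ R) : profile L R s x = 1 - s := by
  rw [profile, cutoff_eq_one (by linarith) (by linarith), cutoff_eq_one hR hx, mul_one]

/-- Where the inner cutoff is nonzero one has |x| < 2R ≤ L, so the outer one equals 1 there. -/
theorem profile_nonneg {L R s : ℝ} (hR : 0 < R) (hRL : 2 * R ≤ L) (hs0 : 0 ≤ s) (hs1 : s ≤ 1)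
    (x : E3) : 0 ≤ profile L R s x := by
  rw [profile]
  by_cases hx : ‖x‖ ≤ L
  · rw [cutoff_eq_one (by linarith) hx]
    nlinarith [cutoff_le_one R x, cutoff_nonneg R x]
  · rw [cutoff_eq_zero hR (by linarith)]
    simpa using cutoff_nonneg L x

theorem profile_le_one (L R : ℝ) {s : ℝ} (hs0 : 0 ≤ s) (x : E3) : profile L R s x ≤ 1 := by
  rw [profile]
  nlinarith [cutoff_le_one L x, cutoff_nonneg R x]

/-- The gradient at scale L is small everywhere; the one at scale R carries a factor s and lives on
a ball of mass at most μ. Only the product s²μ need be small, not s itself. -/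
theorem lintegral_fderiv_profile_le {D : ℝ}
    (hD : ∀ L, 0 < L → ∀ x : E3, ‖fderiv ℝ (cutoff L) x‖ ≤ D / L) (ρ : Measure E3)
    [IsProbabilityMeasure ρ] {L R s μ : ℝ} (hL : 0 < L) (hR : 0 < R) (hs0 : 0 ≤ s) (hμ0 : 0 ≤ μ)
    (hμ : ρ (Metric.closedBall 0 (2 * R)) ≤ ENNReal.ofReal μ) :
    ∫⁻ x, ‖fderiv ℝ (profile L R s) x‖ₑ ^ 2 ∂ρ
      ≤ ENNReal.ofReal (2 * (D / L) ^ 2 + 2 * (D / R) ^ 2 * (s ^ 2 * μ)) := by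
  set B := Metric.closedBall (0 : E3) (2 * R) with hB
  have hBm : MeasurableSet B := Metric.isClosed_closedBall.measurableSet
  have hfd : ∀ x, fderiv ℝ (profile L R s) x
      = fderiv ℝ (cutoff L) x - s • fderiv ℝ (cutoff R) x := by
    intro x
    have d1 := ((contDiff_cutoff L).differentiable (by simp) x).hasFDerivAt
    have d2 := ((contDiff_cutoff R).differentiable (by simp) x).hasFDerivAt
    exact (d1.sub (d2.const_mul s)).fderiv
  have hpt : ∀ x, ‖fderiv ℝ (profile L R s) x‖ₑ ^ 2 ≤ ENNReal.ofReal (2 * (D / L) ^ 2)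
      + B.indicator (fun _ => ENNReal.ofReal (2 * (s * (D / R)) ^ 2)) x := by
    intro x
    rw [hfd, ← ofReal_norm, ← ENNReal.ofReal_pow (norm_nonneg _)]
    by_cases hx : x ∈ B
    · rw [Set.indicator_of_mem hx, ← ENNReal.ofReal_add (by positivity) (by positivity)]
      refine ENNReal.ofReal_le_ofReal ?_
      have h1 : ‖fderiv ℝ (cutoff L) x - s • fderiv ℝ (cutoff R) x‖ ≤ D / L + s * (D / R) := by
        refine (norm_sub_le _ _).trans (add_le_add (hD L hL x) ?_)
        rw [norm_smul, Real.norm_of_nonneg hs0]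
        exact mul_le_mul_of_nonneg_left (hD R hR x) hs0
      have h2 := pow_le_pow_left₀ (norm_nonneg _) h1 2
      nlinarith [sq_nonneg (D / L - s * (D / R))]
    · rw [Set.indicator_of_notMem hx, add_zero, fderiv_cutoff_eq_zero hR hx, smul_zero, sub_zero]
      refine ENNReal.ofReal_le_ofReal ?_
      have h2 := pow_le_pow_left₀ (norm_nonneg _) (hD L hL x) 2
      nlinarith [sq_nonneg (D / L)]
  refine (lintegral_mono hpt).trans ?_
  rw [lintegral_add_left measurable_const, lintegral_indicator_const hBm, lintegral_const,
    measure_univ, mul_one, ENNReal.ofReal_add (by positivity) (by positivity)]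
  gcongr
  calc _ ≤ ENNReal.ofReal (2 * (s * (D / R)) ^ 2) * ENNReal.ofReal μ := by gcongr
    _ = _ := by rw [← ENNReal.ofReal_mul (by positivity)]; congr 1; ring

/-- Beyond L the potential is at most 1/L, and between 2R and L nothing is removed. Inside 2R the
removed fraction is at most 1 − (1 − s)² ≤ 2s, and Hardy on that ball gives 2s · 2√(μT). -/
theorem lintegral_one_sub_profile_le {ρ : Measure E3} [IsProbabilityMeasure ρ]
    (hT : kinetic ρ ≠ ⊤) {L R s μ : ℝ} (hR : 0 < R) (hRL : 2 * R ≤ L) (hs0 : 0 ≤ s) (hs1 : s ≤ 1)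
    (hμ0 : 0 ≤ μ) (hμ : ρ (Metric.closedBall 0 (2 * R)) ≤ ENNReal.ofReal μ) :
    ∫⁻ x, ENNReal.ofReal (1 - profile L R s x ^ 2) * ‖x‖ₑ⁻¹ ∂ρ
      ≤ ENNReal.ofReal (1 / L + 4 * √(s ^ 2 * μ * (kinetic ρ).toReal)) := by
  have hL : 0 < L := by linarith
  set B := Metric.closedBall (0 : E3) (2 * R) with hB
  have hBm : MeasurableSet B := Metric.isClosed_closedBall.measurableSet
  have hpt : ∀ x, ENNReal.ofReal (1 - profile L R s x ^ 2) * ‖x‖ₑ⁻¹ ≤ ENNReal.ofReal (1 / L)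
      + B.indicator (fun x => ENNReal.ofReal (2 * s) * ‖x‖ₑ⁻¹) x := by
    intro x
    have hp0 := profile_nonneg hR hRL hs0 hs1 x
    by_cases hx : ‖x‖ ≤ L
    · by_cases hxB : x ∈ B
      · rw [Set.indicator_of_mem hxB]
        refine le_add_left (mul_le_mul_left (ENNReal.ofReal_le_ofReal ?_) _)
        have h1 : 1 - s ≤ profile L R s x := by
          rw [profile, cutoff_eq_one hL hx]
          nlinarith [cutoff_le_one R x]
        nlinarith [sq_nonneg s]
      · have h1 : profile L R s x = 1 := by
          rw [profile, cutoff_eq_one hL hx,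
            cutoff_eq_zero hR (not_le.1 (mt mem_closedBall_zero_iff.2 hxB)).le]
          simp
        simp [h1]
    · refine le_add_right ?_
      have h1 : ‖x‖ₑ⁻¹ ≤ ENNReal.ofReal (1 / L) := by
        rw [one_div, ENNReal.ofReal_inv_of_pos hL, ENNReal.inv_le_inv, ← ofReal_norm]
        exact ENNReal.ofReal_le_ofReal (by linarith)
      calc _ ≤ 1 * ENNReal.ofReal (1 / L) := by
            gcongr
            rw [← ENNReal.ofReal_one]
            exact ENNReal.ofReal_le_ofReal (by nlinarith)
        _ = _ := one_mul _
  have hsq : ∫⁻ x in B, ‖x‖ₑ⁻¹ ∂ρ ≤ ENNReal.ofReal (2 * √(μ * (kinetic ρ).toReal)) := by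
    rw [← ENNReal.pow_le_pow_left_iff two_ne_zero]
    refine (sq_setLIntegral_inv_norm_le ρ B).trans ?_
    rw [← ENNReal.ofReal_pow (by positivity), mul_pow, Real.sq_sqrt (by positivity),
      ENNReal.ofReal_mul (by norm_num), ENNReal.ofReal_mul hμ0, ENNReal.ofReal_toReal hT]
    norm_num
    gcongr
  refine (lintegral_mono hpt).trans ?_
  rw [lintegral_add_left measurable_const, lintegral_indicator hBm, lintegral_const,
    measure_univ, mul_one, ENNReal.ofReal_add (by positivity) (by positivity),
    lintegral_const_mul' _ _ ENNReal.ofReal_ne_top]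
  gcongr
  calc _ ≤ ENNReal.ofReal (2 * s) * ENNReal.ofReal (2 * √(μ * (kinetic ρ).toReal)) := by gcongr
    _ = _ := by
      rw [← ENNReal.ofReal_mul (by positivity), mul_assoc (s ^ 2),
        Real.sqrt_mul (sq_nonneg s), Real.sqrt_sq hs0]
      congr 1
      ring

theorem exists_relocate_profile_energy_le (N : ℕ) {b Z : ℝ} (hb : 0 < b) (hZ : 0 ≤ Z) {D : ℝ}
    (hD : ∀ L, 0 < L → ∀ x : E3, ‖fderiv ℝ (cutoff L) x‖ ≤ D / L)
    {ρ : Measure E3} [IsProbabilityMeasure ρ] (hE : energy N 1 b Z ρ ≠ ⊤) {L R s μ r θ κ : ℝ}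
    (hR : 0 < R) (hRL : 2 * R ≤ L) (hs0 : 0 ≤ s) (hs1 : s ≤ 1) (hr : 2 * L ≤ r) (hθ : 0 < θ)
    (hκ : 0 < κ) (hμ0 : 0 ≤ μ) (hμ : ρ (Metric.closedBall 0 (2 * R)) ≤ ENNReal.ofReal μ) :
    ∃ ν : Measure E3, IsProbabilityMeasure ν ∧ ν (Metric.ball 0 r) = 0 ∧
      energy N 1 b Z (relocate ρ (profile L R s) ν) ≤ energy N 1 b Z ρ
        + ((θ * (kinetic ρ).toReal
          + 2 * (1 + 1 / θ) * (2 * (D / L) ^ 2 + 2 * (D / R) ^ 2 * (s ^ 2 * μ))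
          + Z * (1 / L + 4 * √(s ^ 2 * μ * (kinetic ρ).toReal)) + κ : ℝ) : EReal) := by
  have hL : 0 < L := by linarith
  obtain ⟨hT, -⟩ := correlation_ne_top_of_energy_ne_top hb hE
  exact exists_relocate_energy_le N hb hZ hE (contDiff_profile L R s)
    (hasCompactSupport_profile hL hR s) (profile_nonneg hR hRL hs0 hs1) (profile_le_one L R hs0)
    (fun x hx => profile_eq_zero hR hRL s (hr.trans hx)) hθ hκ (by positivity) (by positivity)
    (lintegral_fderiv_profile_le hD ρ hL hR hs0 hμ0 hμ)
    (lintegral_one_sub_profile_le hT hR hRL hs0 hs1 hμ0 hμ)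

/-! ### Right semicontinuity in the mass constraint -/

theorem gbR_le {N : ℕ} {b R Z α : ℝ} (ρ : Measure E3) [IsProbabilityMeasure ρ]
    (h : ρ (Metric.ball 0 R) ≤ ENNReal.ofReal α) : gbR N b R Z α ≤ energy N 1 b Z ρ := by
  rw [gbR]
  exact iInf_le_of_le ρ <| iInf_le_of_le inferInstance <| iInf_le_of_le h le_rfl

/-- Semicontinuity of `gbR` from the right in the mass constraint. -/
theorem exists_le_gbR_add (N : ℕ) {b Z : ℝ} (hb : 0 < b) (hZ : 0 ≤ Z) {R α c : ℝ} (hR : 0 < R)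
    (hα : 0 ≤ α) (hc : (c : EReal) < gbR N b R Z α) :
    ∃ δ, 0 < δ ∧ (c : EReal) ≤ gbR N b (3 * R) Z (α + δ) := by
  obtain ⟨D, hD⟩ := exists_norm_fderiv_cutoff_le
  obtain ⟨c', hcc', hc'⟩ := EReal.lt_iff_exists_real_btwn.1 hc
  rw [EReal.coe_lt_coe_iff] at hcc'
  set e := c' - c with he
  have he0 : 0 < e := sub_pos.2 hcc'
  -- M bounds the kinetic energy of every competitor of energy below c. The gap e is split into
  -- quarters, paid by θ, δ, L and κ.
  set M := max 0 (2 * c + 4 * Z ^ 2) with hM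
  have hM0 : 0 ≤ M := le_max_left _ _
  set θ := e / (4 * (M + 1)) with hθ
  have hθ0 : 0 < θ := by positivity
  have hθM : θ * M ≤ e / 4 := by
    rw [hθ, div_mul_eq_mul_div, div_le_div_iff₀ (by positivity) (by norm_num)]
    nlinarith
  obtain ⟨δ, hδ0, hδ⟩ : ∃ δ : ℝ, 0 < δ ∧
      2 * (1 + 1 / θ) * (2 * (D / R) ^ 2 * δ) + Z * (4 * √(δ * M)) ≤ e / 4 := by
    have l : Tendsto (fun δ : ℝ => 2 * (1 + 1 / θ) * (2 * (D / R) ^ 2 * δ) + Z * (4 * √(δ * M)))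
        (𝓝[>] 0) (𝓝 0) := by
      have : ContinuousAt (fun δ : ℝ => 2 * (1 + 1 / θ) * (2 * (D / R) ^ 2 * δ)
        + Z * (4 * √(δ * M))) 0 := by fun_prop
      simpa using this.tendsto.mono_left nhdsWithin_le_nhds
    obtain ⟨δ, hδ, hδ0⟩ := ((l.eventually_le_const (show 0 < e / 4 by positivity)).and
      self_mem_nhdsWithin).exists
    exact ⟨δ, hδ0, hδ⟩
  obtain ⟨L, hL2, hL⟩ : ∃ L : ℝ, 2 * R ≤ L ∧
      2 * (1 + 1 / θ) * (2 * (D / L) ^ 2) + Z * (1 / L) ≤ e / 4 := by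
    have l : Tendsto (fun L : ℝ => 2 * (1 + 1 / θ) * (2 * (D / L) ^ 2) + Z * (1 / L)) atTop
        (𝓝 (2 * (1 + 1 / θ) * (2 * 0 ^ 2) + Z * 0)) :=
      ((((tendsto_const_nhds.div_atTop tendsto_id).pow 2).const_mul 2).const_mul _).add
        ((tendsto_const_nhds.div_atTop tendsto_id).const_mul Z)
    obtain ⟨L, hL, hL2⟩ := ((l.eventually_le_const (show _ < e / 4 by norm_num; positivity)).and
      (eventually_ge_atTop (2 * R))).exists
    exact ⟨L, hL2, hL⟩
  refine ⟨δ, hδ0, ?_⟩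
  rw [gbR]
  refine le_iInf fun ρ => le_iInf fun hρp => le_iInf fun hρ => ?_
  by_contra hlt
  rw [not_le] at hlt
  have hαδ : 0 < α + δ := by linarith
  have hT : (kinetic ρ).toReal ≤ M := (kinetic_toReal_le hb hZ hlt).trans (le_max_right _ _)
  -- Damping by q on the ball of radius R lowers its mass from α + δ to at most α. The damping
  -- region reaches radius 2R, which is why the mass bound is assumed on radius 3R.
  set q := √(α / (α + δ)) with hq
  have hq0 : 0 ≤ q := Real.sqrt_nonneg _
  have hq2 : q ^ 2 * (α + δ) = α := by
    rw [hq, Real.sq_sqrt (by positivity), div_mul_cancel₀ _ hαδ.ne']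
  have hq1 : q ≤ 1 := by
    rw [hq]
    exact Real.sqrt_le_one.2 ((div_le_one hαδ).2 (by linarith))
  -- This stays small even for α = 0, where q = 0 and the damping is total.
  have hs : (1 - q) ^ 2 * (α + δ) ≤ δ := by
    have h1 : (1 - q) ^ 2 ≤ 1 - q ^ 2 := by nlinarith
    nlinarith
  have hμ : ρ (Metric.closedBall 0 (2 * R)) ≤ ENNReal.ofReal (α + δ) :=
    (measure_mono (Metric.closedBall_subset_ball (by linarith))).trans hρ
  obtain ⟨ν, hνp, hν0, hle⟩ := exists_relocate_profile_energy_le N hb hZ hD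
    (hlt.trans (EReal.coe_lt_top c)).ne (L := L) (R := R) (s := 1 - q) (κ := e / 4) hR hL2
    (sub_nonneg.2 hq1) (by linarith) le_rfl hθ0 (by positivity) hαδ.le hμ
  have hpr := isProbabilityMeasure_relocate ρ ν (contDiff_profile L R (1 - q)).continuous.measurable
    (profile_nonneg hR hL2 (sub_nonneg.2 hq1) (by linarith))
    (profile_le_one L R (sub_nonneg.2 hq1))
  have hball : relocate ρ (profile L R (1 - q)) ν (Metric.ball 0 R) ≤ ENNReal.ofReal α := by
    have hνR : ν (Metric.ball 0 R) = 0 :=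
      measure_mono_null (Metric.ball_subset_ball (by linarith)) hν0
    rw [relocate, Measure.add_apply, Measure.smul_apply, hνR, smul_zero, add_zero,
      withDensity_apply _ measurableSet_ball, setLIntegral_congr_fun measurableSet_ball
        (g := fun _ => ENNReal.ofReal (q ^ 2)) (fun x hx => by
          rw [profile_eq_one_sub hR hL2 _ (mem_ball_zero_iff.1 hx).le, sub_sub_cancel]),
      setLIntegral_const]
    calc _ ≤ ENNReal.ofReal (q ^ 2) * ENNReal.ofReal (α + δ) := by
          gcongr
          exact (measure_mono (Metric.ball_subset_ball (by linarith))).trans hρ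
      _ = _ := by rw [← ENNReal.ofReal_mul (sq_nonneg q), hq2]
  -- The relocated measure is admissible for radius R and mass α with energy at most c + e = c',
  -- contradicting c' < `gbR N b R Z α`.
  refine hc'.not_ge ((gbR_le _ hball).trans (hle.trans ((add_le_add_left hlt.le _).trans ?_)))
  rw [← EReal.coe_add, EReal.coe_le_coe_iff]
  have k1 : θ * (kinetic ρ).toReal ≤ e / 4 := (mul_le_mul_of_nonneg_left hT hθ0.le).trans hθM
  have k2 : √((1 - q) ^ 2 * (α + δ) * (kinetic ρ).toReal) ≤ √(δ * M) :=
    Real.sqrt_le_sqrt (by gcongr)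
  have k3 : 2 * (1 + 1 / θ) * (2 * (D / R) ^ 2 * ((1 - q) ^ 2 * (α + δ)))
      ≤ 2 * (1 + 1 / θ) * (2 * (D / R) ^ 2 * δ) := by gcongr
  have k4 : Z * (4 * √((1 - q) ^ 2 * (α + δ) * (kinetic ρ).toReal)) ≤ Z * (4 * √(δ * M)) := by
    gcongr
  rw [mul_add (2 * (1 + 1 / θ)), mul_add Z]
  linarith

/-! ### The Γ-liminf inequality -/

theorem measure_ball_le_of_integral_cutoff (μ : Measure E3) [IsFiniteMeasure μ] {r : ℝ}
    (hr : 0 < r) : μ (Metric.ball 0 r) ≤ ENNReal.ofReal (∫ x, cutoff r x ∂μ) := by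
  have hc := (contDiff_cutoff r).continuous
  have hi : Integrable (cutoff r) μ :=
    hc.integrable_of_hasCompactSupport (hasCompactSupport_cutoff hr)
  rw [ofReal_integral_eq_lintegral_ofReal hi (ae_of_all _ (cutoff_nonneg r)),
    ← lintegral_indicator_one measurableSet_ball]
  refine lintegral_mono fun x => ?_
  by_cases hx : x ∈ Metric.ball (0 : E3) r
  · rw [Set.indicator_of_mem hx, cutoff_eq_one hr (mem_ball_zero_iff.1 hx).le]
    simp
  · simp [Set.indicator_of_notMem hx]

theorem tendsto_integral_cutoff (μ : Measure E3) [IsFiniteMeasure μ] :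
    Tendsto (fun n : ℕ => ∫ x, cutoff (1 / ((n : ℝ) + 1)) x ∂μ) atTop (𝓝 (μ.real {0})) := by
  have h : ∫ x, Set.indicator {(0 : E3)} (fun _ => (1 : ℝ)) x ∂μ = μ.real {0} :=
    integral_indicator_one (measurableSet_singleton _)
  rw [← h]
  refine tendsto_integral_of_dominated_convergence (fun _ => 1)
    (fun n => (contDiff_cutoff _).continuous.aestronglyMeasurable) (integrable_const _)
    (fun n => ae_of_all _ fun x => ?_) (ae_of_all _ fun x => ?_)
  · rw [Real.norm_of_nonneg (cutoff_nonneg _ x)]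
    exact cutoff_le_one _ x
  · have hpos : ∀ n : ℕ, (0 : ℝ) < 1 / ((n : ℝ) + 1) := fun n => by positivity
    by_cases hx : x = 0
    · subst hx
      refine tendsto_const_nhds.congr fun n => ?_
      rw [cutoff_eq_one (hpos n) (by simpa using (hpos n).le)]
      simp
    · have hlim : Tendsto (fun n : ℕ => 2 * (1 / ((n : ℝ) + 1))) atTop (𝓝 (2 * 0)) :=
        tendsto_one_div_add_atTop_nhds_zero_nat.const_mul 2
      rw [mul_zero] at hlim
      have hev := hlim.eventually_le_const (norm_pos_iff.2 hx)
      refine tendsto_const_nhds.congr' (hev.mono fun n hn => ?_)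
      simp only [cutoff_eq_zero (hpos n) hn]
      simp [hx]

theorem SubProb.isFiniteMeasure (ρ : SubProb) : IsFiniteMeasure ρ.toMeasure :=
  ⟨ρ.mass_le_one.trans_lt ENNReal.one_lt_top⟩

theorem isInducing_integral_subProb : Topology.IsInducing
    fun (ρ : SubProb) (f : ZeroAtInftyContinuousMap E3 ℝ) => ∫ x, f x ∂ρ.toMeasure :=
  ⟨rfl⟩

theorem continuous_integral_subProb (f : ZeroAtInftyContinuousMap E3 ℝ) :
    Continuous fun ρ : SubProb => ∫ x, f x ∂ρ.toMeasure :=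
  (continuous_apply f).comp isInducing_integral_subProb.continuous

/-- The cutoff as a function vanishing at infinity. -/
noncomputable def cutoffZeroAtInfty {L : ℝ} (hL : 0 < L) : ZeroAtInftyContinuousMap E3 ℝ where
  toFun := cutoff L
  continuous_toFun := (contDiff_cutoff L).continuous
  zero_at_infty' := (hasCompactSupport_cutoff hL).is_zero_at_infty

theorem energy_map_inv_smul_le_Geps {N : ℕ} {b Z ε : ℝ} (hb : 0 < b) (hZ : 0 ≤ Z) (hε : 0 < ε)
    (ρ : SubProb) (hρ : IsProbabilityMeasure ρ.toMeasure) :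
    energy N 1 b Z (ρ.toMeasure.map fun x => ε⁻¹ • x) ≤ Geps N b Z ε ρ := by
  have h := energy_map_smul_le N zero_le_one hb.le hZ ρ.toMeasure (inv_pos.2 hε)
  rw [Geps, if_pos hρ]
  simpa [mul_comm] using h

/-- A single cutoff of small radius r defines a weak* neighbourhood of μ on which the mass of the
ball of radius r is controlled; μ enters only through its atom at 0. -/
theorem gb_le_Gminus (N : ℕ) {b Z : ℝ} (hb : 0 < b) (hZ : 0 ≤ Z) {α : ℝ} (hα : 0 ≤ α)
    (μ : SubProb) (hμ : μ.toMeasure.real {0} ≤ α) : gb N b Z α ≤ Gminus N b Z μ := by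
  rw [gb]
  refine iSup₂_le fun R hR => EReal.ge_of_forall_gt_iff_ge.1 fun c hc => ?_
  obtain ⟨δ, hδ, hle⟩ := exists_le_gbR_add N hb hZ hR hα hc
  have := μ.isFiniteMeasure
  obtain ⟨n, hn⟩ := ((tendsto_integral_cutoff μ.toMeasure).eventually_lt_const
    (show μ.toMeasure.real {0} < α + δ by linarith)).exists
  set r : ℝ := 1 / ((n : ℝ) + 1) with hr
  have hr0 : 0 < r := by positivity
  set U : Set SubProb := {ρ | ∫ x, cutoff r x ∂ρ.toMeasure < α + δ} with hU
  have hUn : U ∈ 𝓝 μ :=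
    (isOpen_Iio.preimage (continuous_integral_subProb (cutoffZeroAtInfty hr0))).mem_nhds hn
  refine le_trans ?_ (le_iSup₂ (f := fun U (_ : U ∈ 𝓝 μ) =>
    liminf (fun ε => ⨅ y ∈ U, Geps N b Z ε y) (𝓝[>] (0 : ℝ))) U hUn)
  refine le_liminf_of_le (by isBoundedDefault) ?_
  -- The ball of radius 3R in the blown-up picture is the ball of radius 3Rε in the original one,
  -- eventually inside radius r.
  have hev : ∀ᶠ ε : ℝ in 𝓝[>] (0 : ℝ), ε * (3 * R) < r := by
    have : Tendsto (fun ε : ℝ => ε * (3 * R)) (𝓝[>] 0) (𝓝 (0 * (3 * R))) :=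
      (tendsto_id.mono_left nhdsWithin_le_nhds).mul_const _
    rw [zero_mul] at this
    exact this.eventually_lt_const hr0
  filter_upwards [hev, self_mem_nhdsWithin] with ε hεr hε
  have hε0 : 0 < ε := hε
  refine le_iInf₂ fun y hy => ?_
  by_cases hp : IsProbabilityMeasure y.toMeasure
  · refine hle.trans (le_trans ?_ (energy_map_inv_smul_le_Geps hb hZ hε0 y hp))
    have hpm : IsProbabilityMeasure (y.toMeasure.map fun x => ε⁻¹ • x) :=
      Measure.isProbabilityMeasure_map (by fun_prop)
    refine gbR_le _ ?_
    rw [Measure.map_apply (by fun_prop) measurableSet_ball]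
    refine (measure_mono fun x hx => ?_).trans ((measure_ball_le_of_integral_cutoff y.toMeasure
      hr0).trans (ENNReal.ofReal_le_ofReal (le_of_lt hy)))
    rw [Set.mem_preimage, mem_ball_zero_iff, norm_smul, Real.norm_of_nonneg (inv_pos.2 hε0).le,
      inv_mul_lt_iff₀ hε0] at hx
    exact mem_ball_zero_iff.2 (hx.trans hεr)
  · rw [Geps, if_neg hp]
    exact le_top

/-! ### Recovery family and the Γ-limsup inequality -/

theorem continuousOn_integral_cutoff_sq (ρ : Measure E3) [IsFiniteMeasure ρ] :
    ContinuousOn (fun L => ∫ x, cutoff L x ^ 2 ∂ρ) (Set.Ioi 0) := by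
  refine continuousOn_of_dominated (bound := fun _ => 1)
    (fun L _ => ((contDiff_cutoff L).continuous.pow 2).aestronglyMeasurable)
    (fun L _ => ae_of_all _ fun x => ?_) (integrable_const _) (ae_of_all _ fun x => ?_)
  · rw [Real.norm_of_nonneg (sq_nonneg _)]
    exact pow_le_one₀ (cutoff_nonneg L x) (cutoff_le_one L x)
  · refine ContinuousOn.pow ?_ 2
    refine (ContDiffBump.continuous _).comp_continuousOn ?_
    have hinv : ContinuousOn (fun L : ℝ => L⁻¹) (Set.Ioi 0) :=
      continuousOn_inv₀.mono fun L hL => ne_of_gt (Set.mem_Ioi.1 hL)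
    exact hinv.smul continuousOn_const

theorem tendsto_integral_cutoff_sq (ρ : Measure E3) [IsProbabilityMeasure ρ] :
    Tendsto (fun L => ∫ x, cutoff L x ^ 2 ∂ρ) atTop (𝓝 1) := by
  have h : ∫ _, (1 : ℝ) ∂ρ = 1 := by simp
  rw [← h]
  refine tendsto_integral_filter_of_dominated_convergence (fun _ => 1)
    (Eventually.of_forall fun L => ((contDiff_cutoff L).continuous.pow 2).aestronglyMeasurable)
    (Eventually.of_forall fun L => ae_of_all _ fun x => ?_) (integrable_const _)
    (ae_of_all _ fun x => ?_)
  · rw [Real.norm_of_nonneg (sq_nonneg _)]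
    exact pow_le_one₀ (cutoff_nonneg L x) (cutoff_le_one L x)
  · refine tendsto_const_nhds.congr' ?_
    filter_upwards [eventually_ge_atTop ‖x‖, eventually_gt_atTop 0] with L h1 h2
    rw [cutoff_eq_one h2 h1, one_pow]

/-- The scale of the cutoff can be tuned so that almost exactly the mass `α` is retained. -/
theorem exists_integral_cutoff_sq_mem_Icc (ρ : Measure E3) [IsProbabilityMeasure ρ] {α L₀ ε : ℝ}
    (hL₀ : 0 < L₀) (hα0 : 0 ≤ α) (hα1 : α ≤ 1) (hε : 0 < ε)
    (hρ : ρ (Metric.ball 0 (2 * L₀)) ≤ ENNReal.ofReal α) :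
    ∃ L, L₀ ≤ L ∧ ∫ x, cutoff L x ^ 2 ∂ρ ∈ Set.Icc (α - ε) α := by
  set F : ℝ → ℝ := fun L => ∫ x, cutoff L x ^ 2 ∂ρ with hF
  have hF0 : F L₀ ≤ α := by
    have hle : ∫ x, cutoff L₀ x ^ 2 ∂ρ
        ≤ ∫ x, (Metric.ball (0 : E3) (2 * L₀)).indicator (fun _ => (1 : ℝ)) x ∂ρ := by
      refine integral_mono_of_nonneg (ae_of_all _ fun x => sq_nonneg _)
        ((integrable_const _).indicator measurableSet_ball) (ae_of_all _ fun x => ?_)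
      by_cases hx : x ∈ Metric.ball (0 : E3) (2 * L₀)
      · simp only [Set.indicator_of_mem hx]
        exact pow_le_one₀ (cutoff_nonneg L₀ x) (cutoff_le_one L₀ x)
      · simp only [Set.indicator_of_notMem hx]
        rw [cutoff_eq_zero hL₀ (not_lt.1 (mt mem_ball_zero_iff.2 hx))]
        simp
    have h1 : ∫ x, (Metric.ball (0 : E3) (2 * L₀)).indicator (fun _ => (1 : ℝ)) x ∂ρ
        = ρ.real (Metric.ball 0 (2 * L₀)) := integral_indicator_one measurableSet_ball
    rw [h1] at hle
    exact hle.trans (ENNReal.toReal_le_of_le_ofReal hα0 hρ)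
  by_cases h : α - ε ≤ F L₀
  · exact ⟨L₀, le_rfl, h, hF0⟩
  rw [not_le] at h
  -- The retained mass tends to 1 but need not attain it, so the value α − ε is sought rather than
  -- α; this covers α = 1.
  obtain ⟨L₁, hL₁, hL₁'⟩ := (((tendsto_integral_cutoff_sq ρ).eventually_const_lt
    (show α - ε < 1 by linarith)).and (eventually_ge_atTop L₀)).exists
  obtain ⟨L, hL, hLF⟩ := intermediate_value_Icc hL₁'
    ((continuousOn_integral_cutoff_sq ρ).mono fun x hx => hL₀.trans_le hx.1)
    (show α - ε ∈ Set.Icc (F L₀) (F L₁) from ⟨h.le, hL₁.le⟩)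
  refine ⟨L, hL.1, ?_⟩
  change F L ∈ _
  change F L = _ at hLF
  rw [hLF]
  exact ⟨le_rfl, by linarith⟩

theorem integral_relocate (ρ ν : Measure E3) [IsProbabilityMeasure ρ] [IsProbabilityMeasure ν]
    {ζ : E3 → ℝ} (hζ : Continuous ζ) (h0 : ∀ x, 0 ≤ ζ x) (h1 : ∀ x, ζ x ≤ 1) {g : E3 → ℝ}
    (hg : Continuous g) {B : ℝ} (hB : ∀ x, |g x| ≤ B) :
    ∫ x, g x ∂(relocate ρ ζ ν) = ∫ x, ζ x ^ 2 * g x ∂ρ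
      + (∫⁻ x, ENNReal.ofReal (1 - ζ x ^ 2) ∂ρ).toReal * ∫ x, g x ∂ν := by
  have hpr := isProbabilityMeasure_relocate ρ ν hζ.measurable h0 h1
  have hi : Integrable g (relocate ρ ζ ν) :=
    Integrable.of_bound hg.aestronglyMeasurable B (ae_of_all _ hB)
  rw [relocate] at hi ⊢
  rw [integral_add_measure hi.left_of_add_measure hi.right_of_add_measure, integral_smul_measure,
    smul_eq_mul, integral_withDensity_eq_integral_toReal_smul (by fun_prop) (by simp)]
  congr 1
  refine integral_congr_ae (ae_of_all _ fun x => ?_)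
  simp [ENNReal.toReal_ofReal (sq_nonneg (ζ x))]

/-- Three errors: the oscillation of g on the kept mass, the deviation of that mass from α, and the
tail of g seen by ν. -/
theorem abs_integral_relocate_sub_le (ρ ν : Measure E3) [IsProbabilityMeasure ρ]
    [IsProbabilityMeasure ν] {ζ : E3 → ℝ} (hζ : Continuous ζ) (h0 : ∀ x, 0 ≤ ζ x)
    (h1 : ∀ x, ζ x ≤ 1) {g : E3 → ℝ} (hg : Continuous g) {B : ℝ} (hB : ∀ x, |g x| ≤ B)
    {α ε r η : ℝ} (hε : 0 ≤ ε) (hα : ∫ x, ζ x ^ 2 ∂ρ ∈ Set.Icc (α - ε) α)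
    (hν : ν (Metric.ball 0 r) = 0) (hη : ∀ x, r ≤ ‖x‖ → |g x| ≤ η) :
    |∫ x, g x ∂(relocate ρ ζ ν) - α * g 0| ≤ ∫ x, |g x - g 0| ∂ρ + ε * |g 0| + η := by
  rw [integral_relocate ρ ν hζ h0 h1 hg hB]
  set m := ∫⁻ x, ENNReal.ofReal (1 - ζ x ^ 2) ∂ρ with hm
  have hm1 : m.toReal ≤ 1 := ENNReal.toReal_le_of_le_ofReal zero_le_one
    (by simpa using lintegral_one_sub_sq_le_one ρ ζ)
  have hsq : ∀ x, ζ x ^ 2 ≤ 1 := fun x => pow_le_one₀ (h0 x) (h1 x)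
  have i0 : Integrable (fun x => ζ x ^ 2) ρ :=
    Integrable.of_bound (by fun_prop) 1 (ae_of_all _ fun x => by
      rw [Real.norm_of_nonneg (sq_nonneg _)]; exact hsq x)
  have ig : Integrable (fun x => g x - g 0) ρ :=
    (Integrable.of_bound hg.aestronglyMeasurable B (ae_of_all _ hB)).sub (integrable_const _)
  have i1 : Integrable (fun x => ζ x ^ 2 * (g x - g 0)) ρ :=
    ig.norm.mono' (by fun_prop) (ae_of_all _ fun x => by
      rw [norm_mul, Real.norm_of_nonneg (sq_nonneg _)]
      exact mul_le_of_le_one_left (norm_nonneg _) (hsq x))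
  have e1 : ∫ x, ζ x ^ 2 * g x ∂ρ = ∫ x, ζ x ^ 2 * (g x - g 0) ∂ρ + (∫ x, ζ x ^ 2 ∂ρ) * g 0 := by
    rw [← integral_mul_const, ← integral_add i1 (i0.mul_const _)]
    refine integral_congr_ae (ae_of_all _ fun x => ?_)
    ring
  have b1 : |∫ x, ζ x ^ 2 * (g x - g 0) ∂ρ| ≤ ∫ x, |g x - g 0| ∂ρ := by
    refine norm_integral_le_of_norm_le (f := fun x => ζ x ^ 2 * (g x - g 0)) ig.abs
      (ae_of_all _ fun x => ?_)
    rw [norm_mul, Real.norm_of_nonneg (sq_nonneg _)]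
    exact mul_le_of_le_one_left (norm_nonneg _) (hsq x)
  have b2 : |((∫ x, ζ x ^ 2 ∂ρ) - α) * g 0| ≤ ε * |g 0| := by
    rw [abs_mul]
    gcongr
    rw [abs_le]
    constructor <;> linarith [hα.1, hα.2]
  have b3 : |m.toReal * ∫ x, g x ∂ν| ≤ η := by
    have hae : ∀ᵐ x ∂ν, ‖g x‖ ≤ η := by
      rw [ae_iff]
      refine measure_mono_null (fun x hx => ?_) hν
      by_contra hxr
      exact hx (hη x (not_lt.1 (mt mem_ball_zero_iff.2 hxr)))
    have h2 := norm_integral_le_of_norm_le_const hae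
    rw [probReal_univ, mul_one] at h2
    rw [abs_mul, abs_of_nonneg ENNReal.toReal_nonneg]
    calc _ ≤ 1 * η := mul_le_mul hm1 h2 (abs_nonneg _) zero_le_one
      _ = η := one_mul η
  calc _ = |∫ x, ζ x ^ 2 * (g x - g 0) ∂ρ + ((∫ x, ζ x ^ 2 ∂ρ) - α) * g 0
        + m.toReal * ∫ x, g x ∂ν| := by rw [e1]; congr 1; ring
    _ ≤ _ := (abs_add_three _ _ _).trans (by linarith)

theorem tendsto_integral_abs_dilate_sub (ρ : Measure E3) [IsProbabilityMeasure ρ]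
    (f : ZeroAtInftyContinuousMap E3 ℝ) :
    Tendsto (fun ε : ℝ => ∫ x, |f (ε • x) - f 0| ∂ρ) (𝓝[>] 0) (𝓝 0) := by
  have hf : Continuous f := f.continuous
  have hB : ∀ x, |f x| ≤ ‖f.toBCF‖ := fun x => f.toBCF.norm_coe_le_norm x
  have h : ∫ _, (0 : ℝ) ∂ρ = 0 := by simp
  conv => arg 3; rw [← h]
  refine tendsto_integral_filter_of_dominated_convergence (fun _ => ‖f.toBCF‖ + ‖f.toBCF‖)
    (Eventually.of_forall fun ε => by fun_prop)
    (Eventually.of_forall fun ε => ae_of_all _ fun x => ?_) (integrable_const _)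
    (ae_of_all _ fun x => ?_)
  · rw [Real.norm_eq_abs, abs_abs]
    exact (abs_sub _ _).trans (add_le_add (hB _) (hB _))
  · have hc : Continuous fun ε : ℝ => |f (ε • x) - f 0| := by fun_prop
    have := (hc.tendsto 0).mono_left (nhdsWithin_le_nhds (s := Set.Ioi 0))
    simpa using this

theorem exists_abs_le_of_norm_ge (f : ZeroAtInftyContinuousMap E3 ℝ) {η : ℝ} (hη : 0 < η) :
    ∃ A, ∀ x, A ≤ ‖x‖ → |f x| ≤ η := by
  have h := (zero_at_infty f).eventually (Metric.closedBall_mem_nhds 0 hη)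
  rw [← Metric.cobounded_eq_cocompact, ← comap_norm_atTop, eventually_comap] at h
  obtain ⟨A, hA⟩ := eventually_atTop.1 h
  exact ⟨A, fun x hx => by simpa using hA ‖x‖ hx x rfl⟩

theorem Geps_map_smul_le {N : ℕ} {b Z ε : ℝ} (hb : 0 < b) (hZ : 0 ≤ Z) (hε : 0 < ε)
    (ρ : Measure E3) (σ : SubProb) (hσ : σ.toMeasure = ρ.map fun x => ε • x)
    (hp : IsProbabilityMeasure σ.toMeasure) : Geps N b Z ε σ ≤ energy N 1 b Z ρ := by
  have h := energy_map_smul_le N (sq_nonneg ε) (mul_pos hε hb).le (mul_nonneg hε.le hZ) ρ hε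
  rw [Geps, if_pos hp, hσ]
  have e1 : ε ^ 2 * ε⁻¹ ^ 2 = 1 := by field_simp
  have e2 : ε * b * ε⁻¹ = b := by field_simp
  have e3 : ε * Z * ε⁻¹ = Z := by field_simp
  rwa [e1, e2, e3] at h

/-- Recovery family for the upper bound. -/
theorem exists_recovery (N : ℕ) {b Z : ℝ} (hb : 0 < b) (hZ : 0 ≤ Z) {α c : ℝ} (hα0 : 0 ≤ α)
    (hα1 : α ≤ 1) (hc : gb N b Z α < c) :
    ∃ ρ : Measure E3, IsProbabilityMeasure ρ ∧ ∀ ε, 0 < ε → ∃ σ : SubProb,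
      Geps N b Z ε σ ≤ c ∧ ∀ (f : ZeroAtInftyContinuousMap E3 ℝ) (η : ℝ),
        (∀ x, ε⁻¹ ≤ ‖x‖ → |f x| ≤ η) →
        |∫ x, f x ∂σ.toMeasure - α * f 0| ≤ ∫ x, |f (ε • x) - f 0| ∂ρ + ε * |f 0| + η := by
  obtain ⟨D, hD⟩ := exists_norm_fderiv_cutoff_le
  obtain ⟨c', hc', hcc'⟩ := EReal.lt_iff_exists_real_btwn.1 hc
  rw [EReal.coe_lt_coe_iff] at hcc'
  set e := c - c' with he
  have he0 : 0 < e := sub_pos.2 hcc'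
  set M := max 0 (2 * c' + 4 * Z ^ 2) with hM
  have hM0 : 0 ≤ M := le_max_left _ _
  set θ := e / (4 * (M + 1)) with hθ
  have hθ0 : 0 < θ := by positivity
  have hθM : θ * M ≤ e / 4 := by
    rw [hθ, div_mul_eq_mul_div, div_le_div_iff₀ (by positivity) (by norm_num)]
    nlinarith
  -- The bound must hold for every L ≥ L₀, because L will depend on ε. Fixing L₀ first lets ρ be
  -- chosen independently of ε, with its mass constraint on radius 2L₀, which contains the support
  -- of the cutoff at scale L₀.
  obtain ⟨L₀, hL₀, hLb⟩ : ∃ L₀ : ℝ, 0 < L₀ ∧ ∀ L, L₀ ≤ L →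
      2 * (1 + 1 / θ) * (2 * (D / L) ^ 2) + Z * (1 / L) ≤ e / 4 := by
    have l : Tendsto (fun L : ℝ => 2 * (1 + 1 / θ) * (2 * (D / L) ^ 2) + Z * (1 / L)) atTop
        (𝓝 (2 * (1 + 1 / θ) * (2 * 0 ^ 2) + Z * 0)) :=
      ((((tendsto_const_nhds.div_atTop tendsto_id).pow 2).const_mul 2).const_mul _).add
        ((tendsto_const_nhds.div_atTop tendsto_id).const_mul Z)
    obtain ⟨L₀, h⟩ := eventually_atTop.1
      (l.eventually_le_const (show _ < e / 4 by norm_num; positivity))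
    exact ⟨max L₀ 1, by positivity, fun L hL => h L ((le_max_left _ _).trans hL)⟩
  have hgR : gbR N b (2 * L₀) Z α < c' :=
    (le_iSup₂ (f := fun R (_ : 0 < R) => gbR N b R Z α) (2 * L₀) (by positivity)).trans_lt hc'
  rw [gbR] at hgR
  simp only [iInf_lt_iff] at hgR
  obtain ⟨ρ, hρp, hρ, hE⟩ := hgR
  have hT : (kinetic ρ).toReal ≤ M := (kinetic_toReal_le hb hZ hE).trans (le_max_right _ _)
  refine ⟨ρ, hρp, fun ε hε => ?_⟩
  obtain ⟨L, hL₀L, hL⟩ := exists_integral_cutoff_sq_mem_Icc ρ hL₀ hα0 hα1 hε hρ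
  have hL0 : 0 < L := hL₀.trans_le hL₀L
  -- Mass sent beyond ε⁻² still lies beyond ε⁻¹ after dilation by ε, hence escapes as ε → 0.
  set r := max (2 * L) (ε⁻¹ * ε⁻¹) with hr
  -- No damping is needed here: s = 0 makes the inner scale L/2 and the trivial mass bound 1
  -- irrelevant.
  obtain ⟨ν, hνp, hν0, hle⟩ := exists_relocate_profile_energy_le N hb hZ hD
    (hE.trans (EReal.coe_lt_top c')).ne (L := L) (R := L / 2) (s := 0) (μ := 1) (r := r)
    (κ := e / 4) (by positivity) (by linarith) le_rfl zero_le_one (le_max_left _ _) hθ0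
    (by positivity) zero_le_one (by simpa using prob_le_one)
  rw [profile_zero] at hle
  have hcc := (contDiff_cutoff L).continuous
  have hpr := isProbabilityMeasure_relocate ρ ν hcc.measurable (cutoff_nonneg L) (cutoff_le_one L)
  have hpm : IsProbabilityMeasure ((relocate ρ (cutoff L) ν).map fun x => ε • x) :=
    Measure.isProbabilityMeasure_map (by fun_prop)
  refine ⟨⟨(relocate ρ (cutoff L) ν).map fun x => ε • x, by simp⟩, ?_, fun f η hη => ?_⟩
  · refine (Geps_map_smul_le hb hZ hε _ _ rfl hpm).trans
      (hle.trans ((add_le_add_left hE.le _).trans ?_))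
    rw [← EReal.coe_add, EReal.coe_le_coe_iff]
    have k1 : θ * (kinetic ρ).toReal ≤ e / 4 := (mul_le_mul_of_nonneg_left hT hθ0.le).trans hθM
    have k2 := hLb L hL₀L
    simp only [ne_eq, OfNat.ofNat_ne_zero, not_false_eq_true, zero_pow, zero_mul, mul_zero,
      Real.sqrt_zero, add_zero]
    linarith
  · have hf : Continuous f := f.continuous
    rw [integral_map (by fun_prop) hf.aestronglyMeasurable]
    have h := abs_integral_relocate_sub_le ρ ν hcc (cutoff_nonneg L) (cutoff_le_one L)
      (g := fun x => f (ε • x)) (by fun_prop) (B := ‖f.toBCF‖)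
      (fun x => f.toBCF.norm_coe_le_norm (ε • x)) hε.le hL hν0 (fun x hx => hη _ ?_)
    · simpa using h
    · rw [norm_smul, Real.norm_of_nonneg hε.le]
      have h1 : ε⁻¹ * ε⁻¹ ≤ ‖x‖ := (le_max_right _ _).trans hx
      calc ε⁻¹ = ε * (ε⁻¹ * ε⁻¹) := by field_simp
        _ ≤ _ := by gcongr

/-- The recovery family converges weak* to the atom, so it eventually enters each neighbourhood,
where the infimum is then at most c. -/
theorem Gplus_atom_le_gb (N : ℕ) {b Z : ℝ} (hb : 0 < b) (hZ : 0 ≤ Z) {α : ℝ}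
    (hα : α ∈ Set.Icc (0 : ℝ) 1) :
    Gplus N b Z ⟨atomAtZero α, atomAtZero_mass_le_one hα⟩ ≤ gb N b Z α := by
  refine EReal.le_of_forall_lt_iff_le.1 fun c hc => ?_
  obtain ⟨ρ, hρp, hrec⟩ := exists_recovery N hb hZ hα.1 hα.2 hc
  have hrec' : ∀ ε : ℝ, ∃ σ : SubProb, 0 < ε → (Geps N b Z ε σ ≤ c ∧
      ∀ (f : ZeroAtInftyContinuousMap E3 ℝ) (η : ℝ),
        (∀ x, ε⁻¹ ≤ ‖x‖ → |f x| ≤ η) →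
        |∫ x, f x ∂σ.toMeasure - α * f 0| ≤ ∫ x, |f (ε • x) - f 0| ∂ρ + ε * |f 0| + η) := by
    intro ε
    by_cases hε : 0 < ε
    · obtain ⟨σ, hσ⟩ := hrec ε hε
      exact ⟨σ, fun _ => hσ⟩
    · exact ⟨⟨0, by simp⟩, fun h => absurd h hε⟩
  choose σ hσ using hrec'
  have hlim : Tendsto σ (𝓝[>] 0) (𝓝 ⟨atomAtZero α, atomAtZero_mass_le_one hα⟩) := by
    rw [isInducing_integral_subProb.tendsto_nhds_iff, tendsto_pi_nhds]
    intro f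
    have hatom : ∫ x, f x ∂(atomAtZero α) = α * f 0 := by
      rw [atomAtZero, integral_smul_measure, integral_dirac, ENNReal.toReal_ofReal hα.1,
        smul_eq_mul]
    simp only [Function.comp_def, hatom]
    rw [Metric.tendsto_nhds]
    intro η hη
    obtain ⟨A, hA⟩ := exists_abs_le_of_norm_ge f (show 0 < η / 2 by positivity)
    have l1 : Tendsto (fun ε : ℝ => ∫ x, |f (ε • x) - f 0| ∂ρ + ε * |f 0|) (𝓝[>] 0)
        (𝓝 (0 + 0 * |f 0|)) := (tendsto_integral_abs_dilate_sub ρ f).add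
      ((tendsto_id.mono_left nhdsWithin_le_nhds).mul_const _)
    rw [zero_mul, add_zero] at l1
    filter_upwards [l1.eventually_lt_const (show 0 < η / 2 by positivity),
      tendsto_inv_nhdsGT_zero.eventually_ge_atTop A, self_mem_nhdsWithin] with ε h1 h2 hε
    have h3 := (hσ ε hε).2 f (η / 2) fun x hx => hA x (h2.trans hx)
    rw [Real.dist_eq]
    linarith
  rw [Gplus, gammaLimsup]
  refine iSup₂_le fun U hU => ?_
  refine limsup_le_of_le (by isBoundedDefault) ?_
  filter_upwards [hlim hU, self_mem_nhdsWithin] with ε hεU hε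
  exact (iInf₂_le (σ ε) hεU).trans (hσ ε hε).1

theorem Gminus_le_Gplus (N : ℕ) (b Z : ℝ) (μ : SubProb) : Gminus N b Z μ ≤ Gplus N b Z μ :=
  iSup₂_mono fun _ _ => liminf_le_limsup

theorem atomAtZero_real_zero {α : ℝ} (hα : 0 ≤ α) : (atomAtZero α).real {0} = α := by
  simp [atomAtZero, Measure.real, hα]

end Dissoc

theorem mainTheorem6 (N : ℕ) (hN : 1 ≤ N) (b Z : ℝ) (hb : 0 < b) (hZ : 0 ≤ Z) :
    (∀ (α : ℝ) (hα : α ∈ Set.Icc (0 : ℝ) 1),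
      Dissoc.IsGammaLimitAt N b Z
        ⟨Dissoc.atomAtZero α, Dissoc.atomAtZero_mass_le_one hα⟩ (Dissoc.gb N b Z α)) ∧
    (∀ α ∈ Set.Icc (0 : ℝ) 1, ∀ ρperp : MeasureTheory.Measure Dissoc.E3, ρperp {0} = 0 →
      ∀ hρ : (Dissoc.atomAtZero α + ρperp) Set.univ ≤ 1,
        Dissoc.gb N b Z α ≤ Dissoc.Gminus N b Z ⟨Dissoc.atomAtZero α + ρperp, hρ⟩) := by
  refine ⟨fun α hα => ?_, fun α hα ρperp h0 hρ => ?_⟩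
  · have h1 := Dissoc.gb_le_Gminus N hb hZ hα.1
      ⟨Dissoc.atomAtZero α, Dissoc.atomAtZero_mass_le_one hα⟩ (Dissoc.atomAtZero_real_zero hα.1).le
    have h2 := Dissoc.Gminus_le_Gplus N b Z
      ⟨Dissoc.atomAtZero α, Dissoc.atomAtZero_mass_le_one hα⟩
    have h3 := Dissoc.Gplus_atom_le_gb N hb hZ hα
    exact ⟨le_antisymm (h2.trans h3) h1, le_antisymm h3 (h1.trans h2)⟩
  · refine Dissoc.gb_le_Gminus N hb hZ hα.1 _ (le_of_eq ?_)
    rw [MeasureTheory.Measure.real, MeasureTheory.Measure.add_apply, h0, add_zero]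
    exact Dissoc.atomAtZero_real_zero hα.1
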